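/- Let $k$ be an algebraically closed field of characteristic $0$, let $n\ge 1$, and let $F=k\langle\langle x_1,\dots,x_n\rangle\rangle$ be the complete free algebra, whose elements are the formal series $\sum_w a_w w$ over all words $w$ in $x_1,\dots,x_n$. Let $\mathfrak m\subseteq F$ be the two-sided ideal generated by $x_1,\dots,x_n$, and for a subspace $U$ of an algebra with an ideal $I$ let $U^{cl}=\bigcap_{r\ge 1}(U+I^r)$ be its $I$-adic closure. A superpotential is an element $\Phi$ of $F_{cyc}=F/[F,F]^{cl}$ ($\mathfrak m$-adic closure), where $[A,A]$ denotes the linear span of all commutators of an algebra $A$; let $\pi:F\to F_{cyc}$ be the projection. The order of $\Phi$ is the supremum of all $r$ with $\Phi\in\pi(\mathfrak m^r)$. The cyclic derivative $D_i:F\to F$ is the continuous linear map with $D_i(w)=\sum_{w=u x_i v} v u$ for every word $w$; it vanishes on $[F,F]^{cl}$, so that $D_i\Phi\in F$ is defined. The Jacobi algebra of $\Phi$ is $\Lambda(F,\Phi)=F/J(F,\Phi)$, where $J(F,\Phi)$ is the closed two-sided ideal generated by $D_1\Phi,\dots,D_n\Phi$. $\Phi$ is called quasi-homogeneous if its image $[\Phi]$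 in $\Lambda/[\Lambda,\Lambda]^{cl}$ is zero, where $\Lambda=\Lambda(F,\Phi)$ and the closure is taken with respect to the image of $\mathfrak m$ (if $\dim_k\Lambda<\infty$, this quotient is $\Lambda/[\Lambda,\Lambda]$). Two superpotentials are right equivalent if some $k$-algebra automorphism $H$ of $F$ with $H(\mathfrak m)=\mathfrak m$ carries one to the other. For rational numbers $0<r_1,\dots,r_n\le 1/2$, a superpotential is weighted-homogeneous of type $(r_1,\dots,r_n)$ if it has a representative in $F$ that is a linear combination of words $x_{i_1}x_{i_2}\cdots x_{i_p}$ with $r_{i_1}+\dots+r_{i_p}=1$. **Theorem.** Let $\Phi\in F_{cyc}$ be a superpotential of order $\ge 3$ such that $\Lambda(F,\Phi)$ is finite dimensional over $k$. Then $\Phi$ is quasi-homogeneous if and only if $\Phi$ is right equivalent to a weighted-homogeneous superpotential of type $(r_1,\dots,r_n)$ for some rational numbers $r_1,\dots,r_n$ with $0<r_i<1/2$ for all $i$. Moreover, any two such types agree up to a permutation of the indices: if $\Phi$ is right equivalent to a weighted-homogeneous superpotential of type $(r_1,\dots,r_n)$ and to one of type $(s_1,\dots,s_n)$, with all $r_i,s_i$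 rational and strictly between $0$ and $1/2$, then there is a permutation $\sigma$ of $\{1,\dots,n\}$ with $s_i=r_{\sigma(i)}$ for all $i$. -/

import Mathlib

noncomputable section

namespace NCSaito

universe u

/-! ### Splittings of words -/

/-- The sum of `G p q` over all factorizations `w = p ++ q` of the word `w`. -/
def splitSum {k α : Type*} [AddCommMonoid k] (G : List α → List α → k) (w : List α) : k :=
  ∑ j ∈ Finset.range (w.length + 1), G (w.take j) (w.drop j)

section splitSum

variable {k α : Type*}

theorem splitSum_nil [AddCommMonoid k] (G : List α → List α → k) :
    splitSum G [] = G [] [] := by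
  simp [splitSum]

theorem splitSum_cons [AddCommMonoid k] (G : List α → List α → k) (a : α) (w : List α) :
    splitSum G (a :: w) = G [] (a :: w) + splitSum (fun p q => G (a :: p) q) w := by
  simp only [splitSum, List.length_cons]
  rw [Finset.sum_range_succ']
  simp [add_comm]

theorem splitSum_congr [AddCommMonoid k] {G H : List α → List α → k} {w : List α}
    (h : ∀ p q, p ++ q = w → G p q = H p q) : splitSum G w = splitSum H w := by
  unfold splitSum
  exact Finset.sum_congr rfl fun j _ => h _ _ (List.take_append_drop j w)

theorem splitSum_add [AddCommMonoid k] (G H : List α → List α → k) (w : List α) :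
    splitSum (fun p q => G p q + H p q) w = splitSum G w + splitSum H w := by
  simp [splitSum, Finset.sum_add_distrib]

theorem splitSum_zero [AddCommMonoid k] (w : List α) :
    splitSum (fun _ _ => (0 : k)) w = 0 := by
  simp [splitSum]

theorem splitSum_mul_left [Semiring k] (c : k) (G : List α → List α → k) (w : List α) :
    splitSum (fun p q => c * G p q) w = c * splitSum G w := by
  simp [splitSum, Finset.mul_sum]

theorem splitSum_mul_right [Semiring k] (c : k) (G : List α → List α → k) (w : List α) :
    splitSum (fun p q => G p q * c) w = splitSum G w * c := by
  simp [splitSum, Finset.sum_mul]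

theorem splitSum_assoc [AddCommMonoid k] (H : List α → List α → List α → k) (w : List α) :
    splitSum (fun p q => splitSum (fun a b => H a b q) p) w =
      splitSum (fun a p => splitSum (fun b q => H a b q) p) w := by
  induction w generalizing H with
  | nil => simp [splitSum_nil]
  | cons x w ih =>
    simp only [splitSum_cons, splitSum_nil, splitSum_add]
    rw [ih (fun a b q => H (x :: a) b q), add_assoc]

theorem splitSum_append_cons [AddCommMonoid k] (G : List α → List α → k) (p : List α) (a : α)
    (q : List α) :
    splitSum G (p ++ a :: q) =
      splitSum (fun u v => G (p ++ a :: u) v) q + splitSum (fun u v => G u (v ++ a :: q)) p := by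
  induction p generalizing G with
  | nil => simp [splitSum_cons, splitSum_nil, add_comm]
  | cons x p ih =>
    simp only [List.cons_append, splitSum_cons]
    rw [ih]
    abel

end splitSum

/-! ### The complete free algebra -/

/-- The complete free algebra `k⟨⟨x₁, …, xₙ⟩⟩`: formal series `∑ a_w w` over all words `w` in the
letters `x₁, …, xₙ`, encoded by their coefficient functions `w ↦ a_w`. -/
def NCSeries (k : Type u) (n : ℕ) : Type u := List (Fin n) → k

namespace NCSeries

variable {k : Type u} {n : ℕ}

@[ext] theorem ext {f g : NCSeries k n} (h : ∀ w, f w = g w) : f = g := funext h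

instance [CommRing k] : AddCommGroup (NCSeries k n) :=
  inferInstanceAs (AddCommGroup (List (Fin n) → k))

/-- The monomial `w`, with coefficient one. -/
def word (k : Type u) {n : ℕ} [CommRing k] (w : List (Fin n)) : NCSeries k n :=
  fun v => if v = w then 1 else 0

/-- The variable `x_i`. -/
def X (k : Type u) {n : ℕ} [CommRing k] (i : Fin n) : NCSeries k n := word k [i]

instance [CommRing k] : One (NCSeries k n) := ⟨word k []⟩

/-- Concatenation product: the coefficient of `f * g` at `w` is `∑_{w = p q} f_p g_q`. -/
instance [CommRing k] : Mul (NCSeries k n) :=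
  ⟨fun f g w => splitSum (fun p q => f p * g q) w⟩

theorem add_apply [CommRing k] (f g : NCSeries k n) (w : List (Fin n)) :
    (f + g) w = f w + g w := rfl

theorem sub_apply [CommRing k] (f g : NCSeries k n) (w : List (Fin n)) :
    (f - g) w = f w - g w := rfl

theorem zero_apply [CommRing k] (w : List (Fin n)) : (0 : NCSeries k n) w = 0 := rfl

theorem one_apply [CommRing k] (w : List (Fin n)) :
    (1 : NCSeries k n) w = if w = [] then 1 else 0 := rfl

theorem mul_apply [CommRing k] (f g : NCSeries k n) (w : List (Fin n)) :
    (f * g) w = splitSum (fun p q => f p * g q) w := rfl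

protected theorem one_mul [CommRing k] (f : NCSeries k n) : 1 * f = f := by
  ext w
  cases w <;> simp [mul_apply, one_apply, splitSum_nil, splitSum_cons, splitSum_zero]

protected theorem mul_one [CommRing k] (f : NCSeries k n) : f * 1 = f := by
  ext w
  suffices h : ∀ (g : List (Fin n) → k) (w : List (Fin n)),
      splitSum (fun p q => g p * (1 : NCSeries k n) q) w = g w from h f w
  intro g w
  induction w generalizing g with
  | nil => simp [one_apply, splitSum_nil]
  | cons a w ih => rw [splitSum_cons, ih (fun p => g (a :: p))]; simp [one_apply]

protected theorem mul_assoc [CommRing k] (f g h : NCSeries k n) : f * g * h = f * (g * h) := by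
  ext w
  simp only [mul_apply, ← splitSum_mul_left, ← splitSum_mul_right]
  rw [splitSum_assoc (fun a b q => f a * g b * h q)]
  simp only [mul_assoc]

instance [CommRing k] : Ring (NCSeries k n) where
  __ := (inferInstance : AddCommGroup (NCSeries k n))
  mul := (· * ·)
  one := 1
  one_mul := NCSeries.one_mul
  mul_one := NCSeries.mul_one
  mul_assoc := NCSeries.mul_assoc
  zero_mul f := by ext w; simp [mul_apply, zero_apply, splitSum_zero]
  mul_zero f := by ext w; simp [mul_apply, zero_apply, splitSum_zero]
  left_distrib f g h := by
    ext w; simp only [mul_apply, add_apply, mul_add, splitSum_add]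
  right_distrib f g h := by
    ext w; simp only [mul_apply, add_apply, add_mul, splitSum_add]

/-- Scalars act coefficientwise. -/
instance [CommRing k] : Algebra k (NCSeries k n) :=
  letI : Module k (NCSeries k n) := inferInstanceAs (Module k (List (Fin n) → k))
  Algebra.ofModule
    (fun c f g => by
      ext w
      change splitSum (fun p q => c * f p * g q) w = c * splitSum (fun p q => f p * g q) w
      simp only [mul_assoc, splitSum_mul_left])
    (fun c f g => by
      ext w
      change splitSum (fun p q => f p * (c * g q)) w = c * splitSum (fun p q => f p * g q) w
      simp only [mul_left_comm _ c, splitSum_mul_left])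

theorem smul_apply [CommRing k] (c : k) (f : NCSeries k n) (w : List (Fin n)) :
    (c • f) w = c * f w := rfl

end NCSeries

/-! ### Ideals, commutators and adic closures in an algebra -/

section Algebra

variable {k : Type*} [CommRing k] {A B : Type*} [Ring A] [Algebra k A] [Ring B] [Algebra k B]

/-- The two-sided ideal generated by `S`: all finite sums of elements `a * s * b`, `s ∈ S`. -/
def twoSidedSpan (k : Type*) [CommRing k] {A : Type*} [Ring A] [Algebra k A] (S : Set A) :
    Submodule k A :=
  ⊤ * Submodule.span k S * ⊤

/-- The closure `⋂_{r ≥ 1} (U + I^r)` of a subspace `U` in the `I`-adic topology. -/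
def adicClosure (I U : Submodule k A) : Submodule k A := ⨅ r : ℕ, U ⊔ I ^ (r + 1)

/-- The linear span `[A, A]` of all commutators. -/
def commutators (k : Type*) [CommRing k] (A : Type*) [Ring A] [Algebra k A] : Submodule k A :=
  Submodule.span k {c | ∃ a b : A, c = a * b - b * a}

theorem commutators_le_adicClosure (I : Submodule k A) :
    commutators k A ≤ adicClosure I (commutators k A) :=
  le_iInf fun _ => le_sup_left

theorem map_adicClosure_commutators (g : A →ₐ[k] B) (I : Submodule k A) :
    adicClosure I (commutators k A) ≤
      (adicClosure (I.map g.toLinearMap) (commutators k B)).comap g.toLinearMap := by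
  rw [← Submodule.map_le_iff_le_comap]
  refine le_iInf fun r => ?_
  refine (Submodule.map_mono (iInf_le _ r)).trans ?_
  rw [Submodule.map_sup, Submodule.map_pow]
  refine sup_le_sup_right ?_ _
  rw [commutators, Submodule.map_span, Submodule.span_le]
  rintro _ ⟨_, ⟨a, b, rfl⟩, rfl⟩
  exact Submodule.subset_span ⟨g a, g b, by simp⟩

theorem top_mul_twoSidedSpan (S : Set A) : ⊤ * twoSidedSpan k S ≤ twoSidedSpan k S := by
  unfold twoSidedSpan
  rw [← mul_assoc, ← mul_assoc]
  exact mul_le_mul_left (mul_le_mul_left le_top _) _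

theorem twoSidedSpan_mul_top (S : Set A) : twoSidedSpan k S * ⊤ ≤ twoSidedSpan k S := by
  unfold twoSidedSpan
  rw [mul_assoc]
  exact mul_le_mul_right le_top _

theorem top_mul_adicClosure {I U : Submodule k A} (hI : ⊤ * I ≤ I) (hU : ⊤ * U ≤ U) :
    ⊤ * adicClosure I U ≤ adicClosure I U := by
  refine le_iInf fun r => (mul_le_mul_right (iInf_le _ r) _).trans ?_
  rw [Submodule.mul_sup, pow_succ', ← mul_assoc]
  exact sup_le_sup hU (mul_le_mul_left hI _)

theorem adicClosure_mul_top {I U : Submodule k A} (hI : I * ⊤ ≤ I) (hU : U * ⊤ ≤ U) :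
    adicClosure I U * ⊤ ≤ adicClosure I U := by
  refine le_iInf fun r => (mul_le_mul_left (iInf_le _ r) _).trans ?_
  rw [Submodule.sup_mul, pow_succ, mul_assoc]
  exact sup_le_sup hU (mul_le_mul_right hI _)

end Algebra

/-! ### Superpotentials and cyclic derivatives -/

section Superpotentials

variable (k : Type u) [CommRing k] (n : ℕ)

/-- The ideal `𝔪` of `F = k⟨⟨x₁, …, xₙ⟩⟩` generated by `x₁, …, xₙ`. -/
def maxIdeal : Submodule k (NCSeries k n) := twoSidedSpan k (Set.range (NCSeries.X k))

/-- The closed commutator subspace `[F, F]^cl`. -/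
def closedCommutators : Submodule k (NCSeries k n) :=
  adicClosure (maxIdeal k n) (commutators k (NCSeries k n))

/-- Superpotentials: the elements of `F_cyc = F / [F, F]^cl`. -/
abbrev Superpotential : Type u := NCSeries k n ⧸ closedCommutators k n

variable {k n}

/-- The canonical projection `π : F → F_cyc`. -/
abbrev proj : NCSeries k n →ₗ[k] Superpotential k n := (closedCommutators k n).mkQ

/-- The order of a superpotential: the supremum of all `r` with `Φ ∈ π(𝔪^r)`. -/
def order (Φ : Superpotential k n) : ℕ∞ :=
  ⨆ (r : ℕ) (_ : Φ ∈ (maxIdeal k n ^ r).map proj), (r : ℕ∞)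

/-- The cyclic derivative `D_i : F → F`, the continuous linear map with
`D_i w = ∑_{w = u x_i v} v u` on words. The coefficient of `D_i f` at `w` is hence the sum of the
coefficients of `f` at `u x_i v` over all factorizations `w = v u`. -/
def cyclicDer (i : Fin n) : NCSeries k n →ₗ[k] NCSeries k n where
  toFun f w := splitSum (fun v u => f (u ++ i :: v)) w
  map_add' f g := by
    ext w
    exact splitSum_add (fun v u => f (u ++ i :: v)) (fun v u => g (u ++ i :: v)) w
  map_smul' c f := by
    ext w
    exact splitSum_mul_left c (fun v u => f (u ++ i :: v)) w

theorem cyclicDer_apply (i : Fin n) (f : NCSeries k n) (w : List (Fin n)) :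
    cyclicDer i f w = splitSum (fun v u => f (u ++ i :: v)) w := rfl

theorem cyclicDer_mul (i : Fin n) (f g : NCSeries k n) (w : List (Fin n)) :
    cyclicDer i (f * g) w =
      splitSum (fun a q => splitSum (fun b c => f (c ++ i :: a) * g b) q) w +
        splitSum (fun a q => splitSum (fun b c => g (c ++ i :: a) * f b) q) w := by
  simp only [cyclicDer_apply, NCSeries.mul_apply, splitSum_append_cons, splitSum_add]
  rw [splitSum_assoc (fun a b c => f (c ++ i :: a) * g b)]
  simp only [mul_comm]

theorem cyclicDer_mul_comm (i : Fin n) (f g : NCSeries k n) :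
    cyclicDer i (f * g) = cyclicDer i (g * f) := by
  ext w
  rw [cyclicDer_mul, cyclicDer_mul, add_comm]

theorem maxIdeal_apply_nil {f : NCSeries k n} (hf : f ∈ maxIdeal k n) : f [] = 0 := by
  have hle : ∀ U V : Submodule k (NCSeries k n), (∀ x ∈ U, x [] = 0) ∨ (∀ x ∈ V, x [] = 0) →
      ∀ x ∈ U * V, x [] = 0 := by
    intro U V h x hx
    induction hx using Submodule.mul_induction_on' with
    | mem_mul_mem a ha b hb =>
      rw [NCSeries.mul_apply, splitSum_nil]
      rcases h with h | h
      · rw [h a ha, zero_mul]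
      · rw [h b hb, mul_zero]
    | add a _ b _ h1 h2 => rw [NCSeries.add_apply, h1, h2, add_zero]
  refine hle _ _ (Or.inl (hle _ _ (Or.inr ?_))) f hf
  intro x hx
  induction hx using Submodule.span_induction with
  | mem x hx =>
    obtain ⟨i, rfl⟩ := hx
    simp [NCSeries.X, NCSeries.word]
  | zero => rfl
  | add a b _ _ h1 h2 => rw [NCSeries.add_apply, h1, h2, add_zero]
  | smul c a _ h1 => rw [NCSeries.smul_apply, h1, mul_zero]

theorem maxIdeal_pow_apply {r : ℕ} {f : NCSeries k n} (hf : f ∈ maxIdeal k n ^ r)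
    {w : List (Fin n)} (hw : w.length < r) : f w = 0 := by
  induction r generalizing f w with
  | zero => simp at hw
  | succ r ih =>
    rw [pow_succ] at hf
    induction hf using Submodule.mul_induction_on' with
    | mem_mul_mem a ha b hb =>
      rw [NCSeries.mul_apply, ← splitSum_zero w]
      refine splitSum_congr fun p q hpq => ?_
      rcases q with _ | ⟨x, q⟩
      · rw [maxIdeal_apply_nil hb, mul_zero]
      · have hl := congrArg List.length hpq
        simp only [List.length_append, List.length_cons] at hl
        rw [ih ha (by omega), zero_mul]
    | add a _ b _ h1 h2 => rw [NCSeries.add_apply, h1, h2, add_zero]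

theorem closedCommutators_le_ker (i : Fin n) :
    closedCommutators k n ≤ LinearMap.ker (cyclicDer (k := k) i) := by
  intro f hf
  rw [LinearMap.mem_ker]
  ext w
  have hf' := (Submodule.mem_iInf _).1 hf (w.length + 1)
  obtain ⟨c, hc, g, hg, rfl⟩ := Submodule.mem_sup.1 hf'
  have h1 : cyclicDer i c = 0 := by
    have hle : commutators k (NCSeries k n) ≤ LinearMap.ker (cyclicDer (k := k) i) := by
      rw [commutators, Submodule.span_le]
      rintro _ ⟨a, b, rfl⟩
      simp only [SetLike.mem_coe, LinearMap.mem_ker, map_sub]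
      rw [cyclicDer_mul_comm, sub_self]
    exact hle hc
  rw [map_add, h1, zero_add, cyclicDer_apply, NCSeries.zero_apply, ← splitSum_zero w]
  refine splitSum_congr fun p q hpq => maxIdeal_pow_apply hg ?_
  have hl := congrArg List.length hpq
  simp only [List.length_append, List.length_cons] at hl ⊢
  omega

/-- The cyclic derivative `D_i Φ ∈ F` of a superpotential, computed on any representative. -/
def cyclicDeriv (i : Fin n) : Superpotential k n →ₗ[k] NCSeries k n :=
  (closedCommutators k n).liftQ (cyclicDer i) (closedCommutators_le_ker i)

/-! ### The Jacobi algebra -/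

/-- The Jacobi ideal `J(F, Φ)`: the closed two-sided ideal of `F` generated by the cyclic
derivatives `D_1 Φ, …, D_n Φ`. -/
def jacobiIdeal (Φ : Superpotential k n) : Ideal (NCSeries k n) where
  toAddSubmonoid :=
    (adicClosure (maxIdeal k n)
      (twoSidedSpan k (Set.range fun i => cyclicDeriv i Φ))).toAddSubmonoid
  smul_mem' a _ hx :=
    top_mul_adicClosure (top_mul_twoSidedSpan _) (top_mul_twoSidedSpan _)
      (Submodule.mul_mem_mul (Submodule.mem_top (x := a)) hx)

instance (Φ : Superpotential k n) : (jacobiIdeal Φ).IsTwoSided where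
  mul_mem_of_left b hx :=
    adicClosure_mul_top (twoSidedSpan_mul_top _) (twoSidedSpan_mul_top _)
      (Submodule.mul_mem_mul hx (Submodule.mem_top (x := b)))

/-- The Jacobi algebra `Λ(F, Φ) = F / J(F, Φ)`. -/
abbrev JacobiAlgebra (Φ : Superpotential k n) : Type u := NCSeries k n ⧸ jacobiIdeal Φ

/-- The quotient map `F → Λ(F, Φ)`. -/
abbrev toJacobi (Φ : Superpotential k n) : NCSeries k n →ₐ[k] JacobiAlgebra Φ :=
  Ideal.Quotient.mkₐ k (jacobiIdeal Φ)

/-- The image of `𝔪` in the Jacobi algebra. -/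
def jacobiMaxIdeal (Φ : Superpotential k n) : Submodule k (JacobiAlgebra Φ) :=
  (maxIdeal k n).map (toJacobi Φ).toLinearMap

/-- `Λ(F, Φ)_cyc = Λ / [Λ, Λ]^cl`, which is `Λ / [Λ, Λ]` if `Λ` is finite dimensional. -/
abbrev JacobiCyc (Φ : Superpotential k n) : Type u :=
  JacobiAlgebra Φ ⧸ adicClosure (jacobiMaxIdeal Φ) (commutators k (JacobiAlgebra Φ))

/-- The map `F_cyc → Λ(F, Φ)_cyc`, `Θ ↦ [Θ]`, induced by the projection `F → Λ(F, Φ)`. -/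
def classMap (Φ : Superpotential k n) : Superpotential k n →ₗ[k] JacobiCyc Φ :=
  Submodule.mapQ _ _ (toJacobi Φ).toLinearMap
    (map_adicClosure_commutators (toJacobi Φ) (maxIdeal k n))

/-- `Φ` is quasi-homogeneous if its class `[Φ]` in `Λ(F, Φ)_cyc` is zero. -/
def IsQuasiHomogeneous (Φ : Superpotential k n) : Prop := classMap Φ Φ = 0

/-! ### Right equivalence and weighted homogeneity -/

variable (k n) in
/-- The group of `k`-algebra automorphisms of `F` that preserve `𝔪`. -/
def autGroup : Subgroup (NCSeries k n ≃ₐ[k] NCSeries k n) where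
  carrier := {H | (maxIdeal k n).map H.toAlgHom.toLinearMap = maxIdeal k n}
  one_mem' := Submodule.map_id (maxIdeal k n)
  mul_mem' := by
    intro G H hG hH
    have hc := Submodule.map_comp H.toAlgHom.toLinearMap G.toAlgHom.toLinearMap (maxIdeal k n)
    rw [show (maxIdeal k n).map H.toAlgHom.toLinearMap = maxIdeal k n from hH,
      show (maxIdeal k n).map G.toAlgHom.toLinearMap = maxIdeal k n from hG] at hc
    exact hc
  inv_mem' := by
    intro H hH
    have hc := Submodule.map_comp H.toAlgHom.toLinearMap H⁻¹.toAlgHom.toLinearMap (maxIdeal k n)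
    rw [show (maxIdeal k n).map H.toAlgHom.toLinearMap = maxIdeal k n from hH] at hc
    have hid : H⁻¹.toAlgHom.toLinearMap ∘ₗ H.toAlgHom.toLinearMap = LinearMap.id :=
      LinearMap.ext fun x => H.symm_apply_apply x
    rw [hid, Submodule.map_id] at hc
    exact hc.symm

/-- The action of an automorphism of `F` that preserves `𝔪` on superpotentials. -/
def autAct (H : autGroup k n) : Superpotential k n →ₗ[k] Superpotential k n :=
  Submodule.mapQ _ _ H.1.toAlgHom.toLinearMap <| by
    have h := map_adicClosure_commutators H.1.toAlgHom (maxIdeal k n)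
    rw [show (maxIdeal k n).map H.1.toAlgHom.toLinearMap = maxIdeal k n from H.2] at h
    exact h

/-- Right equivalence: `Φ` and `Ψ` lie in the same orbit of automorphisms preserving `𝔪`. -/
def RightEquivalent (Φ Ψ : Superpotential k n) : Prop := ∃ H : autGroup k n, autAct H Φ = Ψ

/-- `Φ` is weighted-homogeneous of type `(r₁, …, rₙ)`, where `0 < r_i ≤ 1/2`, if it has a
representative in which only words `x_{i₁} ⋯ x_{iₚ}` with `r_{i₁} + ⋯ + r_{iₚ} = 1` occur.
There are finitely many such words, since all weights are positive. -/
def IsWeightedHomogeneous (r : Fin n → ℚ) (Φ : Superpotential k n) : Prop :=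
  (∀ i, 0 < r i ∧ r i ≤ 1 / 2) ∧
    ∃ φ : NCSeries k n, proj φ = Φ ∧ ∀ w : List (Fin n), φ w ≠ 0 → (w.map r).sum = 1

end Superpotentials

end NCSaito

end

/-! Everything is expressed through derivations `ξ` of `F` that fix the superpotential, that is,
with `ξ φ - φ` in the closed commutator space. Modulo that space `ξ φ` equals the sum of the `ξ(x_i)
* D_i φ`, and `ξ` is determined by arbitrary values `ξ(x_i)`. When `Λ` is finite dimensional, the
Jacobi ideal contains all series of some order `N`, and by Nakayama it is the ordinary two-sided
ideal generated by the `D_i φ`. Hence `φ` is quasi-homogeneous exactly when some derivation fixes it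
(`exists_isDer_of_isQuasiHomogeneous`, `isQuasiHomogeneous_of_isDer`).

Existence of weights. Such a `ξ` preserves `𝔪` (`isDer_X_mem_tail`). A basis of generalized
eigenvectors of its linear part lifts to topological generalized eigenvectors in `F`, which serve as
new coordinates. Words in them are generalized eigenvectors for the sums of the eigenvalues `l i`,
so only words of weight one survive in `φ` (`exists_normalForm`). Finite dimensionality forces, for
each `i`, a word `x_i^p x_j x_i^q` with `2 ≤ p + q ≤ N` to occur (`exists_word_of_tail_le_jac`). The
resulting equations `a * l i + l j = 1` with `a ≥ 2` survive a `ℚ`-linear retraction `k → ℚ` and put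
the rational weights strictly between `0` and `1/2` (`weights_pos_lt_half`).

Uniqueness. A weighted-homogeneous form of type `r` gives, by transporting the Euler derivation, a
derivation that fixes `φ` and whose linear part has eigenvalues `r i`. For two such derivations `ξ`,
`η`, every member of the line `ξ + t (η - ξ)` fixes `φ`, so its eigenvalues solve one of the systems
above. With `a ≤ N` there are finitely many systems, each with at most one solution
(`finite_weights`). A pencil of matrices with eigenvalues in a finite set has constant
characteristic polynomial (`charpoly_eq_add_of_finite`), so `r` and `s` agree as multisets. -/

noncomputable section

namespace NCSaito

universe u

/-! ### Order filtration, limits, homomorphisms and derivations of `F`. -/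

section Basics

variable {k : Type u} [Field k] {n : ℕ}

open NCSeries

/-! ### The order filtration -/

variable (k n) in
/-- The series all of whose words have length at least `r`. -/
def tail (r : ℕ) : Submodule k (NCSeries k n) where
  carrier := {f | ∀ w : List (Fin n), w.length < r → f w = 0}
  add_mem' hf hg w hw := by rw [NCSeries.add_apply, hf w hw, hg w hw, add_zero]
  zero_mem' _ _ := rfl
  smul_mem' c f hf w hw := by rw [NCSeries.smul_apply, hf w hw, mul_zero]

theorem mem_tail_zero (f : NCSeries k n) : f ∈ tail k n 0 := fun _ h => absurd h (by omega)

theorem tail_anti {r s : ℕ} (h : r ≤ s) : tail k n s ≤ tail k n r :=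
  fun _ hf w hw => hf w (lt_of_lt_of_le hw h)

theorem eq_zero_of_mem_tail {f : NCSeries k n} (h : ∀ r, f ∈ tail k n r) : f = 0 :=
  NCSeries.ext fun w => h (w.length + 1) w (by omega)

theorem mul_mem_tail {r s : ℕ} {f g : NCSeries k n} (hf : f ∈ tail k n r) (hg : g ∈ tail k n s) :
    f * g ∈ tail k n (r + s) := by
  intro w hw
  rw [mul_apply, ← splitSum_zero w]
  refine splitSum_congr fun p q hpq => ?_
  have hl := congrArg List.length hpq
  rw [List.length_append] at hl
  by_cases hp : p.length < r
  · rw [hf p hp, zero_mul]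
  · rw [hg q (by omega), mul_zero]

theorem mul_mem_tail_left {r : ℕ} {f : NCSeries k n} (g : NCSeries k n) (hf : f ∈ tail k n r) :
    g * f ∈ tail k n r := by
  simpa using mul_mem_tail (mem_tail_zero g) hf

theorem mul_mem_tail_right {r : ℕ} {f : NCSeries k n} (g : NCSeries k n) (hf : f ∈ tail k n r) :
    f * g ∈ tail k n r := by
  simpa using mul_mem_tail hf (mem_tail_zero g)

/-- The coefficient series of the words starting with `x_i`, with this letter removed. -/
def lder (i : Fin n) : NCSeries k n →ₗ[k] NCSeries k n where
  toFun f w := f (i :: w)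
  map_add' _ _ := rfl
  map_smul' _ _ := rfl

theorem lder_apply (i : Fin n) (f : NCSeries k n) (w : List (Fin n)) :
    lder i f w = f (i :: w) := rfl

theorem lder_mem_tail {r : ℕ} {f : NCSeries k n} (hf : f ∈ tail k n (r + 1)) (i : Fin n) :
    lder i f ∈ tail k n r := fun w hw => hf (i :: w) (by simpa using hw)

theorem X_mul_apply_nil (i : Fin n) (g : NCSeries k n) : (X k i * g) [] = 0 := by
  simp [mul_apply, splitSum_nil, X, word]

theorem X_mul_apply_cons (i j : Fin n) (g : NCSeries k n) (w : List (Fin n)) :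
    (X k i * g) (j :: w) = if j = i then g w else 0 := by
  rw [mul_apply, splitSum_cons]
  cases w with
  | nil => simp [splitSum_nil, X, word]
  | cons a w =>
    rw [splitSum_cons]
    have : splitSum (fun p q => X k i (j :: a :: p) * g q) w = 0 := by
      rw [← splitSum_zero w]
      exact splitSum_congr fun p q _ => by simp [X, word]
    rw [this]
    simp [X, word]

theorem X_mem_tail (i : Fin n) : X k i ∈ tail k n 1 := by
  intro w hw
  obtain rfl : w = [] := List.length_eq_zero_iff.1 (by omega)
  simp [X, word]

theorem sum_apply {ι : Type*} (s : Finset ι) (f : ι → NCSeries k n) (w : List (Fin n)) :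
    (∑ i ∈ s, f i) w = ∑ i ∈ s, f i w := Finset.sum_apply (M := fun _ => k) w s f

theorem smul_one_apply (c : k) (w : List (Fin n)) :
    (c • (1 : NCSeries k n)) w = if w = [] then c else 0 := by
  rw [NCSeries.smul_apply, NCSeries.one_apply]; simp

theorem eq_const_add_sum (f : NCSeries k n) :
    f = f [] • (1 : NCSeries k n) + ∑ i, X k i * lder i f := by
  ext w
  rw [NCSeries.add_apply, sum_apply, smul_one_apply]
  cases w with
  | nil => simp [X_mul_apply_nil]
  | cons a w => simp [X_mul_apply_cons, lder_apply]

theorem eq_sum_of_mem_tail {f : NCSeries k n} (hf : f ∈ tail k n 1) :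
    f = ∑ i, X k i * lder i f := by
  conv_lhs => rw [eq_const_add_sum f, hf [] (by simp)]
  simp

theorem lder_one (i : Fin n) : lder i (1 : NCSeries k n) = 0 := by
  ext w
  simp [lder_apply, NCSeries.one_apply, NCSeries.zero_apply]

theorem lder_X (i j : Fin n) : lder i (X k j) = if i = j then 1 else 0 := by
  have h := X_mul_apply_cons (k := k) j i 1
  ext w
  rw [lder_apply, ← mul_one (X k j), h]
  split_ifs <;> rfl

theorem lder_mul (i : Fin n) (f g : NCSeries k n) :
    lder i (f * g) = lder i f * g + f [] • lder i g := by
  ext w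
  rw [lder_apply, mul_apply, splitSum_cons, add_comm, NCSeries.add_apply, NCSeries.smul_apply]
  rfl

theorem word_nil : word k ([] : List (Fin n)) = 1 := rfl

theorem word_cons (i : Fin n) (w : List (Fin n)) : word k (i :: w) = X k i * word k w := by
  ext v
  cases v with
  | nil => simp [X_mul_apply_nil, word]
  | cons a v =>
    rw [X_mul_apply_cons]
    by_cases h : a = i <;> simp [word, h]

theorem word_mem_tail (w : List (Fin n)) : word k w ∈ tail k n w.length := by
  intro v hv
  have : v ≠ w := by rintro rfl; omega
  simp [word, this]

/-! ### The powers of the maximal ideal -/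

theorem X_mem_maxIdeal (i : Fin n) : X k i ∈ maxIdeal k n := by
  have h := Submodule.mul_mem_mul (Submodule.mul_mem_mul
    (Submodule.mem_top (R := k) (x := (1 : NCSeries k n)))
    (Submodule.subset_span (R := k) (Set.mem_range_self (f := X k) i)))
    (Submodule.mem_top (R := k) (x := (1 : NCSeries k n)))
  simpa [maxIdeal, twoSidedSpan] using h

theorem maxIdeal_mul_right {f : NCSeries k n} (hf : f ∈ maxIdeal k n) (g : NCSeries k n) :
    f * g ∈ maxIdeal k n :=
  twoSidedSpan_mul_top _ (Submodule.mul_mem_mul hf (Submodule.mem_top (x := g)))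

/-- The exponent is shifted because `maxIdeal k n ^ 0` consists of the constants only, whereas `tail
k n 0` is all of `F`. -/
theorem maxIdeal_pow_succ (r : ℕ) : maxIdeal k n ^ (r + 1) = tail k n (r + 1) := by
  apply le_antisymm
  · exact fun f hf w hw => maxIdeal_pow_apply hf hw
  · induction r with
    | zero =>
      intro f hf
      rw [zero_add, pow_one, eq_sum_of_mem_tail hf]
      exact Submodule.sum_mem _ fun i _ => maxIdeal_mul_right (X_mem_maxIdeal i) _
    | succ r ih =>
      intro f hf
      rw [eq_sum_of_mem_tail (tail_anti (by omega) hf), pow_succ']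
      exact Submodule.sum_mem _ fun i _ =>
        Submodule.mul_mem_mul (X_mem_maxIdeal i) (ih (lder_mem_tail hf i))

theorem maxIdeal_eq : maxIdeal k n = tail k n 1 := by
  simpa using maxIdeal_pow_succ (k := k) (n := n) 0

theorem mem_adicClosure {U : Submodule k (NCSeries k n)} {f : NCSeries k n} :
    f ∈ adicClosure (maxIdeal k n) U ↔ ∀ r, f ∈ U ⊔ tail k n r := by
  simp only [adicClosure, Submodule.mem_iInf, maxIdeal_pow_succ]
  exact ⟨fun h r => sup_le_sup_left (tail_anti (Nat.le_succ r)) _ (h r), fun h r => h _⟩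

/-! ### Density of words, limits -/

/-- A subspace that is closed in the `𝔪`-adic topology. -/
def IsAdicClosed (U : Submodule k (NCSeries k n)) : Prop :=
  ∀ f, (∀ r, f ∈ U ⊔ tail k n r) → f ∈ U

theorem isAdicClosed_bot : IsAdicClosed (⊥ : Submodule k (NCSeries k n)) := by
  intro f hf
  simp only [bot_sup_eq] at hf
  exact (Submodule.mem_bot k).2 (eq_zero_of_mem_tail hf)

theorem isAdicClosed_adicClosure (U : Submodule k (NCSeries k n)) :
    IsAdicClosed (adicClosure (maxIdeal k n) U) := by
  intro f hf
  refine mem_adicClosure.2 fun r => ?_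
  obtain ⟨g, hg, t, ht, rfl⟩ := Submodule.mem_sup.1 (hf r)
  exact add_mem (mem_adicClosure.1 hg r) (Submodule.mem_sup_right ht)

theorem exists_polynomial (f : NCSeries k n) (r : ℕ) :
    ∃ p ∈ Submodule.span k (Set.range (word k (n := n))), f - p ∈ tail k n r := by
  induction r generalizing f with
  | zero => exact ⟨0, zero_mem _, mem_tail_zero _⟩
  | succ r ih =>
    choose p hp hpt using fun i => ih (lder i f)
    refine ⟨f [] • (1 : NCSeries k n) + ∑ i, X k i * p i, ?_, ?_⟩
    · refine add_mem (Submodule.smul_mem _ _ (Submodule.subset_span ⟨[], rfl⟩))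
        (Submodule.sum_mem _ fun i _ => ?_)
      have hle : Submodule.span k (Set.range (word k (n := n))) ≤
          (Submodule.span k (Set.range (word k))).comap (LinearMap.mulLeft k (X k i)) := by
        rw [Submodule.span_le]
        rintro _ ⟨w, rfl⟩
        exact Submodule.subset_span ⟨i :: w, word_cons i w⟩
      exact hle (hp i)
    · nth_rewrite 1 [eq_const_add_sum f]
      rw [add_sub_add_left_eq_sub, ← Finset.sum_sub_distrib]
      refine Submodule.sum_mem _ fun i _ => ?_
      rw [← mul_sub, add_comm r 1]
      exact mul_mem_tail (X_mem_tail i) (hpt i)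

/-- Polynomials are dense and `T` is continuous, so words suffice. The shift `s` admits operators
that lower the order, such as derivatives. -/
theorem mem_of_forall_word_mem {U : Submodule k (NCSeries k n)} (hU : IsAdicClosed U)
    (T : NCSeries k n →ₗ[k] NCSeries k n) (s : ℕ)
    (hT : ∀ r, ∀ f ∈ tail k n (r + s), T f ∈ tail k n r) (hw : ∀ w, T (word k w) ∈ U)
    (f : NCSeries k n) : T f ∈ U := by
  refine hU _ fun r => ?_
  obtain ⟨p, hp, hpt⟩ := exists_polynomial f (r + s)
  have hpU : Submodule.span k (Set.range (word k (n := n))) ≤ U.comap T := by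
    rw [Submodule.span_le]
    rintro _ ⟨w, rfl⟩
    exact hw w
  rw [show T f = T p + T (f - p) by rw [← map_add]; simp]
  exact add_mem (Submodule.mem_sup_left (hpU hp)) (Submodule.mem_sup_right (hT r _ hpt))

theorem exists_limit (s : ℕ → NCSeries k n) (hs : ∀ j, s (j + 1) - s j ∈ tail k n j) :
    ∃ f : NCSeries k n, ∀ j, f - s j ∈ tail k n j := by
  have key : ∀ j m, s (j + m) - s j ∈ tail k n j := by
    intro j m
    induction m with
    | zero => simp
    | succ m ih =>
      rw [← sub_add_sub_cancel _ (s (j + m))]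
      exact add_mem (tail_anti (by omega) (hs (j + m))) ih
  -- The coefficient at `w` no longer changes from index `w.length + 1` on.
  refine ⟨fun w => s (w.length + 1) w, fun j w hw => ?_⟩
  have h := key (w.length + 1) (j - (w.length + 1)) w (by omega)
  rw [show w.length + 1 + (j - (w.length + 1)) = j by omega, NCSeries.sub_apply, sub_eq_zero] at h
  exact sub_eq_zero.2 h.symm

/-- A linear endomorphism inducing the identity on the graded pieces of the filtration is
bijective. -/
theorem bijective_of_unipotent (T : NCSeries k n →ₗ[k] NCSeries k n)
    (hT : ∀ r, ∀ f ∈ tail k n r, T f - f ∈ tail k n (r + 1)) : Function.Bijective T := by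
  constructor
  · rw [← LinearMap.ker_eq_bot, LinearMap.ker_eq_bot']
    intro f hf
    refine eq_zero_of_mem_tail fun r => ?_
    induction r with
    | zero => exact mem_tail_zero f
    | succ r ih => simpa [hf] using hT r f ih
  · intro g
    -- Successive approximation: adding the error `g - T f` to `f` raises the order of the error by
    -- one.
    let s : ℕ → NCSeries k n := fun j => Nat.rec 0 (fun _ f => f + (g - T f)) j
    have hs : ∀ j, s (j + 1) = s j + (g - T (s j)) := fun j => rfl
    have he : ∀ j, g - T (s j) ∈ tail k n j := by
      intro j
      induction j with
      | zero => exact mem_tail_zero _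
      | succ j ih =>
        have := neg_mem (hT j _ ih)
        rw [hs, map_add]
        convert this using 1
        abel
    obtain ⟨f, hf⟩ := exists_limit s fun j => by rw [hs, add_sub_cancel_left]; exact he j
    refine ⟨f, ?_⟩
    rw [← sub_eq_zero]
    refine eq_zero_of_mem_tail fun j => ?_
    have h1 : T (f - s j) ∈ tail k n j := by
      have := add_mem (tail_anti (Nat.le_succ j) (hT j _ (hf j))) (hf j)
      simpa using this
    have := sub_mem h1 (he j)
    rw [map_sub] at this
    convert this using 1
    abel

/-- The recursion is contracting because every `B i` has positive order. Substitutions (`A` the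
constant term, `B i` the image of `x_i`) and derivations (`A f = ∑ g i * lder i f`, `B i = x_i`)
both arise this way. -/
theorem exists_recursive (A : NCSeries k n →ₗ[k] NCSeries k n) (B : Fin n → NCSeries k n)
    (hB : ∀ i, B i ∈ tail k n 1) :
    ∃ T : NCSeries k n →ₗ[k] NCSeries k n, ∀ f, T f = A f + ∑ i, B i * T (lder i f) := by
  let step : (NCSeries k n →ₗ[k] NCSeries k n) → (NCSeries k n →ₗ[k] NCSeries k n) :=
    fun S => A + ∑ i, LinearMap.mulLeft k (B i) ∘ₗ S ∘ₗ lder i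
  have hstep : ∀ S f, step S f = A f + ∑ i, B i * S (lder i f) := fun S f => by
    simp [step]
  let S : ℕ → (NCSeries k n →ₗ[k] NCSeries k n) := fun j => Nat.rec 0 (fun _ => step) j
  have hS : ∀ j f, S (j + 1) f = A f + ∑ i, B i * S j (lder i f) := fun j f => hstep _ _
  have hd : ∀ j f, S (j + 1) f - S j f ∈ tail k n j := by
    intro j
    induction j with
    | zero => exact fun f => mem_tail_zero _
    | succ j ih =>
      intro f
      rw [hS (j + 1), hS j, add_sub_add_left_eq_sub, ← Finset.sum_sub_distrib]
      refine Submodule.sum_mem _ fun i _ => ?_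
      rw [← mul_sub]
      have := mul_mem_tail (hB i) (ih (lder i f))
      rwa [Nat.add_comm 1 j] at this
  choose T hT using fun f => exists_limit (fun j => S j f) fun j => hd j f
  refine ⟨{ toFun := T, map_add' := ?_, map_smul' := ?_ }, ?_⟩
  · intro f g
    rw [← sub_eq_zero]
    refine eq_zero_of_mem_tail fun j => ?_
    have := sub_mem (hT (f + g) j) (add_mem (hT f j) (hT g j))
    simp only [map_add] at this
    convert this using 1
    abel
  · intro c f
    rw [← sub_eq_zero]
    refine eq_zero_of_mem_tail fun j => ?_
    have := sub_mem (hT (c • f) j) (Submodule.smul_mem _ c (hT f j))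
    simp only [map_smul, smul_sub] at this
    convert this using 1
    simp
  · intro f
    change T f = A f + ∑ i, B i * T (lder i f)
    rw [← sub_eq_zero]
    refine eq_zero_of_mem_tail fun j => ?_
    have h1 : ∑ i, B i * (T (lder i f) - S j (lder i f)) ∈ tail k n j :=
      Submodule.sum_mem _ fun i _ => mul_mem_tail_left _ (hT _ j)
    have := sub_mem (tail_anti (Nat.le_succ j) (hT f (j + 1))) h1
    simp only [mul_sub, Finset.sum_sub_distrib] at this
    rw [hS] at this
    convert this using 1
    abel

/-! ### Algebra homomorphisms and derivations -/

/-- Continuity is automatic: a series without constant term is a finite sum of products `x_i * lder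
i f`, which `G` respects without any limit. -/
theorem map_mem_tail {G : NCSeries k n →ₐ[k] NCSeries k n} (hG : ∀ i, G (X k i) ∈ tail k n 1)
    {r : ℕ} {f : NCSeries k n} (hf : f ∈ tail k n r) : G f ∈ tail k n r := by
  induction r generalizing f with
  | zero => exact mem_tail_zero _
  | succ r ih =>
    rw [eq_sum_of_mem_tail (tail_anti (by omega) hf), map_sum]
    refine Submodule.sum_mem _ fun i _ => ?_
    rw [map_mul, add_comm r 1]
    exact mul_mem_tail (hG i) (ih (lder_mem_tail hf i))

/-- Substitution of series without constant term for the variables. -/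
theorem exists_substitution (g : Fin n → NCSeries k n) (hg : ∀ i, g i ∈ tail k n 1) :
    ∃ G : NCSeries k n →ₐ[k] NCSeries k n, ∀ i, G (X k i) = g i := by
  let A : NCSeries k n →ₗ[k] NCSeries k n :=
    { toFun := fun f => f [] • (1 : NCSeries k n)
      map_add' := fun f h => by rw [NCSeries.add_apply, add_smul]
      map_smul' := fun c f => by rw [NCSeries.smul_apply, mul_smul]; rfl }
  obtain ⟨T, hT⟩ := exists_recursive A g hg
  replace hT : ∀ f, T f = f [] • (1 : NCSeries k n) + ∑ i, g i * T (lder i f) := hT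
  have h1 : T 1 = 1 := by
    rw [hT]
    simp [lder_one, NCSeries.one_apply]
  have hmul : ∀ f h, T (f * h) = T f * T h := by
    intro f h
    rw [← sub_eq_zero]
    refine eq_zero_of_mem_tail fun j => ?_
    induction j generalizing f h with
    | zero => exact mem_tail_zero _
    | succ j ih =>
      -- The defect of multiplicativity at `(f, h)` is a combination of the defects at `(lder i f,
      -- h)` with coefficients of positive order, so it has arbitrarily high order.
      have e : T (f * h) - T f * T h =
          ∑ i, g i * (T (lder i f * h) - T (lder i f) * T h) := by
        have e2 : f [] • T h = f [] • (h [] • (1 : NCSeries k n) + ∑ i, g i * T (lder i h)) := by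
          rw [← hT]
        rw [hT (f * h), hT f, add_mul, smul_one_mul, e2]
        simp only [lder_mul, map_add, map_smul, mul_add, mul_sub, Finset.sum_add_distrib,
          Finset.sum_sub_distrib, mul_smul_comm, smul_add, Finset.smul_sum, Finset.sum_mul,
          mul_assoc, mul_apply, splitSum_nil, mul_smul]
        abel
      rw [e]
      refine Submodule.sum_mem _ fun i _ => ?_
      rw [add_comm j 1]
      exact mul_mem_tail (hg i) (ih _ _)
  refine ⟨AlgHom.ofLinearMap T h1 hmul, fun i => ?_⟩
  rw [AlgHom.ofLinearMap_apply, hT]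
  have h0 : X k i [] = 0 := X_mem_tail i [] (by simp)
  simp [lder_X, h0, apply_ite T, h1]

/-- A linear map satisfying the Leibniz rule. -/
def IsDer (ξ : NCSeries k n →ₗ[k] NCSeries k n) : Prop :=
  ∀ f g, ξ (f * g) = ξ f * g + f * ξ g

theorem exists_isDer (g : Fin n → NCSeries k n) :
    ∃ ξ : NCSeries k n →ₗ[k] NCSeries k n, IsDer ξ ∧ ∀ i, ξ (X k i) = g i := by
  let A : NCSeries k n →ₗ[k] NCSeries k n := ∑ i, LinearMap.mulLeft k (g i) ∘ₗ lder i
  obtain ⟨T, hT⟩ := exists_recursive A (X k) X_mem_tail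
  replace hT : ∀ f, T f = ∑ i, g i * lder i f + ∑ i, X k i * T (lder i f) := fun f => by
    rw [hT f]; simp [A]
  have h1 : T 1 = 0 := by
    rw [hT]
    simp [lder_one]
  refine ⟨T, fun f h => ?_, fun i => ?_⟩
  · rw [← sub_eq_zero]
    refine eq_zero_of_mem_tail fun j => ?_
    induction j generalizing f h with
    | zero => exact mem_tail_zero _
    | succ j ih =>
      have e : T (f * h) - (T f * h + f * T h) =
          ∑ i, X k i * (T (lder i f * h) - (T (lder i f) * h + lder i f * T h)) := by
        have e1 : f * T h = f [] • T h + ∑ i, X k i * (lder i f * T h) := by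
          conv_lhs => rw [eq_const_add_sum f]
          rw [add_mul, smul_one_mul, Finset.sum_mul]
          simp only [mul_assoc]
        have e2 : f [] • T h = f [] • (∑ i, g i * lder i h + ∑ i, X k i * T (lder i h)) := by
          rw [← hT]
        rw [e1, e2, hT (f * h), hT f]
        simp only [lder_mul, map_add, map_smul, mul_add, mul_sub, Finset.sum_add_distrib,
          Finset.sum_sub_distrib, mul_smul_comm, smul_add, Finset.smul_sum, Finset.sum_mul,
          mul_assoc, add_mul]
        abel
      rw [e]
      refine Submodule.sum_mem _ fun i _ => ?_
      rw [add_comm j 1]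
      exact mul_mem_tail (X_mem_tail i) (ih _ _)
  · rw [hT]
    simp [lder_X, apply_ite T, h1]

namespace IsDer

variable {ξ : NCSeries k n →ₗ[k] NCSeries k n}

theorem map_one (hξ : IsDer ξ) : ξ 1 = 0 := by
  have h := hξ 1 1
  simpa using h

/-- One order may be lost, since `ξ(x_i)` is allowed a constant term here. -/
theorem map_tail_succ (hξ : IsDer ξ) {r : ℕ} {f : NCSeries k n} (hf : f ∈ tail k n (r + 1)) :
    ξ f ∈ tail k n r := by
  induction r generalizing f with
  | zero => exact mem_tail_zero _
  | succ r ih =>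
    rw [eq_sum_of_mem_tail (tail_anti (by omega) hf), map_sum]
    refine Submodule.sum_mem _ fun i _ => ?_
    rw [hξ]
    refine add_mem (mul_mem_tail_left _ (lder_mem_tail hf i)) ?_
    rw [add_comm r 1]
    exact mul_mem_tail (X_mem_tail i) (ih (lder_mem_tail hf i))

theorem map_tail (hξ : IsDer ξ) (h : ∀ i, ξ (X k i) ∈ tail k n 1) {r : ℕ} {f : NCSeries k n}
    (hf : f ∈ tail k n r) : ξ f ∈ tail k n r := by
  induction r generalizing f with
  | zero => exact mem_tail_zero _
  | succ r ih =>
    rw [eq_sum_of_mem_tail (tail_anti (by omega) hf), map_sum]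
    refine Submodule.sum_mem _ fun i _ => ?_
    rw [hξ, add_comm r 1]
    exact add_mem (mul_mem_tail (h i) (lder_mem_tail hf i))
      (mul_mem_tail (X_mem_tail i) (ih (lder_mem_tail hf i)))

theorem map_commutators (hξ : IsDer ξ) :
    commutators k (NCSeries k n) ≤ (commutators k (NCSeries k n)).comap ξ := by
  rw [commutators, Submodule.span_le]
  rintro _ ⟨a, b, rfl⟩
  have e : ξ (a * b - b * a) = (ξ a * b - b * ξ a) + (a * ξ b - ξ b * a) := by
    rw [map_sub, hξ, hξ]; abel
  rw [SetLike.mem_coe, Submodule.mem_comap, e]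
  exact add_mem (Submodule.subset_span ⟨_, _, rfl⟩) (Submodule.subset_span ⟨_, _, rfl⟩)

theorem map_closedCommutators (hξ : IsDer ξ) {f : NCSeries k n}
    (hf : f ∈ closedCommutators k n) : ξ f ∈ closedCommutators k n := by
  refine mem_adicClosure.2 fun r => ?_
  obtain ⟨c, hc, t, ht, rfl⟩ := Submodule.mem_sup.1 (mem_adicClosure.1 hf (r + 1))
  rw [map_add]
  exact add_mem (Submodule.mem_sup_left (hξ.map_commutators hc))
    (Submodule.mem_sup_right (hξ.map_tail_succ ht))

end IsDer

theorem mul_sub_mul_mem (f g : NCSeries k n) : f * g - g * f ∈ closedCommutators k n :=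
  commutators_le_adicClosure _ (Submodule.subset_span ⟨f, g, rfl⟩)

end Basics

theorem splitSum_comm {k α : Type*} [AddCommMonoid k] (K : List α → List α → List α → List α → k)
    (p q : List α) :
    splitSum (fun b c => splitSum (fun u v => K b c u v) p) q =
      splitSum (fun u v => splitSum (fun b c => K b c u v) q) p := by
  simp only [splitSum]
  exact Finset.sum_comm

/-! ### Double derivatives: product rule, chain rule, and their interaction with derivations. -/

section PartialDerivatives

variable {k : Type u} [Field k] {n : ℕ}

open NCSeries

/-! ### Double derivatives -/

/-- The double derivative of `f` by `x_i` applied to `h`: on a word `f` it is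
`∑_{f = u x_i v} v h u`. -/
def pder (i : Fin n) : NCSeries k n →ₗ[k] NCSeries k n →ₗ[k] NCSeries k n :=
  LinearMap.mk₂ k
    (fun f h w => splitSum (fun a q => splitSum (fun b c => f (c ++ i :: a) * h b) q) w)
    (fun f g h => by
      ext w
      simp only [NCSeries.add_apply, add_mul, splitSum_add]
      rfl)
    (fun c f h => by
      ext w
      simp only [NCSeries.smul_apply, mul_assoc, splitSum_mul_left]
      rfl)
    (fun f g h => by
      ext w
      simp only [NCSeries.add_apply, mul_add, splitSum_add]
      rfl)
    (fun c f h => by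
      ext w
      simp only [NCSeries.smul_apply, mul_left_comm _ c, splitSum_mul_left]
      rfl)

theorem pder_apply (i : Fin n) (f h : NCSeries k n) (w : List (Fin n)) :
    pder i f h w = splitSum (fun a q => splitSum (fun b c => f (c ++ i :: a) * h b) q) w := rfl

/-- If the marked letter lies in `f = u x_i v`, the rotated word is `v g h u`; if it lies in `g = u
x_i v`, it is `v h f u`. The inserted factor `h` makes the family closed under this rule, so
inductions on words go through with `h` generalized. -/
theorem pder_mul (i : Fin n) (f g h : NCSeries k n) :
    pder i (f * g) h = pder i f (g * h) + pder i g (h * f) := by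
  ext w
  simp only [NCSeries.add_apply, pder_apply, mul_apply, splitSum_append_cons, add_mul,
    splitSum_add, ← splitSum_mul_right, ← splitSum_mul_left]
  congr 1
  · refine (splitSum_congr fun a q _ =>
      splitSum_comm (fun b c u v => f (c ++ i :: u) * g v * h b) a q).trans ?_
    rw [splitSum_assoc (fun u v q => splitSum (fun b c => f (c ++ i :: u) * g v * h b) q)]
    refine splitSum_congr fun u q _ => ?_
    rw [splitSum_assoc (fun v b c => f (c ++ i :: u) * (g v * h b))]
    simp only [mul_assoc]
  · refine splitSum_congr fun a q _ => ?_
    rw [splitSum_assoc (fun b u v => g (v ++ i :: a) * (h b * f u))]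
    refine splitSum_congr fun b p _ => splitSum_congr fun u v _ => by ring

theorem pder_one_left (i : Fin n) (h : NCSeries k n) : pder i 1 h = 0 := by
  ext w
  rw [pder_apply, NCSeries.zero_apply, ← splitSum_zero w]
  refine splitSum_congr fun a q _ => ?_
  rw [← splitSum_zero q]
  exact splitSum_congr fun b c _ => by simp [NCSeries.one_apply]

theorem pder_one_right (i : Fin n) (f : NCSeries k n) : pder i f 1 = cyclicDer i f := by
  ext w
  rw [pder_apply, cyclicDer_apply]
  refine splitSum_congr fun a q _ => ?_
  have h : splitSum (fun b c => (1 : NCSeries k n) b * f (c ++ i :: a)) q = f (q ++ i :: a) :=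
    congrFun (NCSeries.one_mul (fun c => f (c ++ i :: a) : NCSeries k n)) q
  simpa only [mul_comm] using h

theorem pder_X (i j : Fin n) (h : NCSeries k n) :
    pder i (X k j) h = if i = j then h else 0 := by
  have key : ∀ a c : List (Fin n), X k j (c ++ i :: a) =
      if i = j then (1 : NCSeries k n) a * (1 : NCSeries k n) c else 0 := by
    intro a c
    cases c with
    | nil =>
      by_cases hij : i = j <;> simp [X, word, NCSeries.one_apply, hij]
    | cons x c => simp [X, word, NCSeries.one_apply]
  ext w
  simp only [pder_apply, key]
  by_cases hij : i = j
  · simp only [hij, if_true, mul_assoc]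
    have e : ∀ a q, splitSum (fun b c => (1 : NCSeries k n) a * ((1 : NCSeries k n) c * h b)) q =
        (1 : NCSeries k n) a * (h * 1) q := by
      intro a q
      rw [mul_apply, ← splitSum_mul_left]
      exact splitSum_congr fun b c _ => by ring
    simp only [e]
    rw [← mul_apply, mul_one, one_mul]
  · simp [hij, splitSum_zero, NCSeries.zero_apply]

theorem pder_X_mul (i j : Fin n) (f h : NCSeries k n) :
    pder i (X k j * f) h = (if i = j then f * h else 0) + pder i f (h * X k j) := by
  rw [pder_mul, pder_X]

theorem pder_mem_tail {r : ℕ} {f : NCSeries k n} (hf : f ∈ tail k n (r + 1)) (i : Fin n)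
    (h : NCSeries k n) : pder i f h ∈ tail k n r := by
  intro w hw
  rw [pder_apply, ← splitSum_zero w]
  refine splitSum_congr fun a q haq => ?_
  rw [← splitSum_zero q]
  refine splitSum_congr fun b c hbc => ?_
  have h1 := congrArg List.length haq
  have h2 := congrArg List.length hbc
  rw [List.length_append] at h1 h2
  rw [hf _ (by rw [List.length_append, List.length_cons]; omega), zero_mul]

theorem pder_mem_tail_right {r : ℕ} {h : NCSeries k n} (hh : h ∈ tail k n r) (i : Fin n)
    (f : NCSeries k n) : pder i f h ∈ tail k n r := by
  intro w hw
  rw [pder_apply, ← splitSum_zero w]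
  refine splitSum_congr fun a q haq => ?_
  rw [← splitSum_zero q]
  refine splitSum_congr fun b c hbc => ?_
  have h1 := congrArg List.length haq
  have h2 := congrArg List.length hbc
  rw [List.length_append] at h1 h2
  rw [hh b (by omega), mul_zero]

theorem cyclicDer_mem_tail {r : ℕ} {f : NCSeries k n} (hf : f ∈ tail k n (r + 1)) (i : Fin n) :
    cyclicDer i f ∈ tail k n r := by
  rw [← pder_one_right]
  exact pder_mem_tail hf i 1

/-- On words, `pder i f h` is a sum of terms `v h u`, each in the ideal; closedness of `U` does the
rest. -/
theorem pder_mem {U : Submodule k (NCSeries k n)} (hU : IsAdicClosed U)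
    (hl : ∀ f, ∀ h ∈ U, f * h ∈ U) (hr : ∀ f, ∀ h ∈ U, h * f ∈ U) (i : Fin n)
    (f : NCSeries k n) {h : NCSeries k n} (hh : h ∈ U) : pder i f h ∈ U := by
  refine mem_of_forall_word_mem hU ((pder i).flip h) 1
    (fun r f hf => pder_mem_tail hf i h) (fun w => ?_) f
  rw [LinearMap.flip_apply]
  induction w generalizing h with
  | nil => rw [word_nil, pder_one_left]; exact zero_mem _
  | cons j w ih =>
    rw [word_cons, pder_X_mul]
    refine add_mem ?_ (ih (hr _ _ hh))
    split_ifs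
    · exact hl _ _ hh
    · exact zero_mem _

/-- The chain rule for algebra homomorphisms. -/
theorem pder_map {G : NCSeries k n →ₐ[k] NCSeries k n} (hG : ∀ i, G (X k i) ∈ tail k n 1)
    (i : Fin n) (f h : NCSeries k n) :
    pder i (G f) (G h) = ∑ l, pder i (G (X k l)) (G (pder l f h)) := by
  let T : NCSeries k n →ₗ[k] NCSeries k n := (pder i).flip (G h) ∘ₗ G.toLinearMap -
    ∑ l, pder i (G (X k l)) ∘ₗ G.toLinearMap ∘ₗ (pder l).flip h
  have hT : ∀ f, T f = pder i (G f) (G h) - ∑ l, pder i (G (X k l)) (G (pder l f h)) := by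
    intro f
    simp [T]
  rw [← sub_eq_zero, ← hT, ← Submodule.mem_bot k]
  refine mem_of_forall_word_mem isAdicClosed_bot T 1 (fun r f hf => ?_) (fun w => ?_) f
  · rw [hT]
    exact sub_mem (pder_mem_tail (map_mem_tail hG hf) _ _)
      (Submodule.sum_mem _ fun l _ =>
        pder_mem_tail_right (map_mem_tail hG (pder_mem_tail hf l h)) _ _)
  · rw [Submodule.mem_bot, hT, sub_eq_zero]
    clear hT T
    induction w generalizing h with
    | nil => simp [word_nil, pder_one_left]
    | cons j w ih =>
      rw [word_cons, map_mul, pder_mul, ← map_mul, ← map_mul, ih]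
      simp only [pder_X_mul, map_add, Finset.sum_add_distrib]
      congr 1
      rw [Finset.sum_eq_single j]
      · simp
      · intro l _ hl
        simp [hl]
      · simp

theorem cyclicDer_map {G : NCSeries k n →ₐ[k] NCSeries k n} (hG : ∀ i, G (X k i) ∈ tail k n 1)
    (i : Fin n) (f : NCSeries k n) :
    cyclicDer i (G f) = ∑ l, pder i (G (X k l)) (G (cyclicDer l f)) := by
  simp only [← pder_one_right]
  rw [← pder_map hG, map_one G]

/-- The commutator of a derivation with a double derivative. -/
theorem pder_isDer {ξ : NCSeries k n →ₗ[k] NCSeries k n} (hξ : IsDer ξ) (i : Fin n)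
    (f h : NCSeries k n) :
    pder i (ξ f) h + pder i f (ξ h) =
      ξ (pder i f h) + ∑ l, pder i (ξ (X k l)) (pder l f h) := by
  let T : NCSeries k n →ₗ[k] NCSeries k n := (pder i).flip h ∘ₗ ξ + (pder i).flip (ξ h) -
    (ξ ∘ₗ (pder i).flip h + ∑ l, pder i (ξ (X k l)) ∘ₗ (pder l).flip h)
  have hT : ∀ f, T f = pder i (ξ f) h + pder i f (ξ h) -
      (ξ (pder i f h) + ∑ l, pder i (ξ (X k l)) (pder l f h)) := by
    intro f
    simp [T]
  rw [← sub_eq_zero, ← hT, ← Submodule.mem_bot k]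
  refine mem_of_forall_word_mem isAdicClosed_bot T 2 (fun r f hf => ?_) (fun w => ?_) f
  · rw [hT]
    refine sub_mem (add_mem (pder_mem_tail (hξ.map_tail_succ hf) _ _)
      (pder_mem_tail (tail_anti (by omega) hf) _ _))
      (add_mem (hξ.map_tail_succ (pder_mem_tail hf _ _)) (Submodule.sum_mem _ fun l _ =>
        pder_mem_tail_right (pder_mem_tail (tail_anti (by omega) hf) _ _) _ _))
  · rw [Submodule.mem_bot, hT, sub_eq_zero]
    clear hT T
    induction w generalizing h with
    | nil => simp [word_nil, pder_one_left, hξ.map_one]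
    | cons j w ih =>
      have e := ih (h * X k j)
      have s : ∑ l, pder i (ξ (X k l)) (pder l (X k j * word k w) h) =
          pder i (ξ (X k j)) (word k w * h) +
            ∑ l, pder i (ξ (X k l)) (pder l (word k w) (h * X k j)) := by
        simp only [pder_X_mul, map_add, Finset.sum_add_distrib]
        congr 1
        rw [Finset.sum_eq_single j]
        · simp
        · intro l _ hl
          simp [hl]
        · simp
      rw [word_cons, s, hξ, map_add, LinearMap.add_apply, pder_mul i (ξ (X k j)), pder_X_mul,
        pder_X_mul, pder_X_mul, map_add]
      rw [hξ h, map_add] at e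
      have e' : ξ (if i = j then word k w * h else 0) =
          (if i = j then ξ (word k w) * h else 0) + (if i = j then word k w * ξ h else 0) := by
        split_ifs
        · rw [hξ]
        · simp
      rw [e']
      rw [← sub_eq_zero] at e ⊢
      rw [← e]
      abel

theorem cyclicDer_isDer {ξ : NCSeries k n →ₗ[k] NCSeries k n} (hξ : IsDer ξ) (i : Fin n)
    (f : NCSeries k n) :
    cyclicDer i (ξ f) = ξ (cyclicDer i f) + ∑ l, pder i (ξ (X k l)) (cyclicDer l f) := by
  simp only [← pder_one_right]
  rw [← pder_isDer hξ, hξ.map_one, map_zero, add_zero]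

/-- A term `h u ξ(x_i) v` of `h * ξ f` rotates, modulo commutators, to `ξ(x_i) v h u`. The induction
moves the first letter of the word into `h`. -/
theorem isDer_sub_sum_mem {ξ : NCSeries k n →ₗ[k] NCSeries k n} (hξ : IsDer ξ)
    (f h : NCSeries k n) :
    h * ξ f - ∑ i, ξ (X k i) * pder i f h ∈ closedCommutators k n := by
  let T : NCSeries k n →ₗ[k] NCSeries k n := LinearMap.mulLeft k h ∘ₗ ξ -
    ∑ i, LinearMap.mulLeft k (ξ (X k i)) ∘ₗ (pder i).flip h
  have hT : ∀ f, T f = h * ξ f - ∑ i, ξ (X k i) * pder i f h := by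
    intro f
    simp [T]
  rw [← hT]
  refine mem_of_forall_word_mem (isAdicClosed_adicClosure _) T 1 (fun r f hf => ?_)
    (fun w => ?_) f
  · rw [hT]
    exact sub_mem (mul_mem_tail_left _ (hξ.map_tail_succ hf))
      (Submodule.sum_mem _ fun l _ => mul_mem_tail_left _ (pder_mem_tail hf l h))
  · rw [hT]
    clear hT T
    induction w generalizing h with
    | nil => simp [word_nil, pder_one_left, hξ.map_one]
    | cons j w ih =>
      have s : ∑ l, ξ (X k l) * (pder l (X k j * word k w) h) =
          ξ (X k j) * (word k w * h) +
            ∑ l, ξ (X k l) * (pder l (word k w) (h * X k j)) := by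
        simp only [pder_X_mul, mul_add, Finset.sum_add_distrib]
        congr 1
        rw [Finset.sum_eq_single j]
        · simp
        · intro l _ hl
          simp [hl]
        · simp
      rw [word_cons, s, hξ]
      have := add_mem (ih (h * X k j)) (mul_sub_mul_mem h (ξ (X k j) * word k w))
      convert this using 1
      simp only [mul_add, mul_assoc]
      abel

/-- This is the dictionary between derivations acting on a superpotential and elements of its Jacobi
ideal. -/
theorem isDer_sub_sum_cyclicDer_mem {ξ : NCSeries k n →ₗ[k] NCSeries k n} (hξ : IsDer ξ)
    (f : NCSeries k n) :
    ξ f - ∑ i, ξ (X k i) * cyclicDer i f ∈ closedCommutators k n := by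
  simpa only [one_mul, pder_one_right] using isDer_sub_sum_mem hξ f 1

end PartialDerivatives

/-! ### The Jacobi ideal, and quasi-homogeneity as the existence of a derivation fixing `φ`. -/

section Jacobi

variable {k : Type u} [Field k] {n : ℕ}

open NCSeries

/-! ### Nakayama's lemma for the order filtration -/

/-- The coefficient series of the words starting with `u`, with this prefix removed. -/
def lderWord (u : List (Fin n)) : NCSeries k n →ₗ[k] NCSeries k n where
  toFun f w := f (u ++ w)
  map_add' _ _ := rfl
  map_smul' _ _ := rfl

theorem lderWord_apply (u : List (Fin n)) (f : NCSeries k n) (w : List (Fin n)) :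
    lderWord u f w = f (u ++ w) := rfl

theorem word_mul_apply (u : List (Fin n)) (g : NCSeries k n) (v : List (Fin n)) :
    (word k u * g) v = if u = v.take u.length then g (v.drop u.length) else 0 := by
  induction u generalizing v with
  | nil => simp [word_nil]
  | cons a u ih =>
    rw [word_cons, mul_assoc]
    cases v with
    | nil => simp [X_mul_apply_nil]
    | cons b v =>
      rw [X_mul_apply_cons, ih]
      by_cases h : b = a
      · simp [h]
      · simp [h, Ne.symm h]

theorem eq_sum_word_mul {N : ℕ} {f : NCSeries k n} (hf : f ∈ tail k n N) :
    f = ∑ u ∈ (List.finite_length_eq (Fin n) N).toFinset, word k u * lderWord u f := by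
  ext v
  rw [sum_apply]
  simp only [word_mul_apply, lderWord_apply]
  by_cases hv : v.length < N
  · rw [hf v hv, Finset.sum_eq_zero]
    intro u hu
    have hu' : u.length = N := by simpa using hu
    rw [if_neg]
    intro h
    have := congrArg List.length h
    rw [List.length_take] at this
    omega
  · rw [Finset.sum_eq_single (v.take N)]
    · have h : (v.take N).length = N := by rw [List.length_take]; omega
      rw [h, if_pos rfl, List.take_append_drop]
    · intro u hu hne
      have hu' : u.length = N := by simpa using hu
      rw [hu', if_neg hne]
    · intro h
      exact absurd (by simp; omega) h

/-- Nakayama for right ideals. Each word `u` of length `N` is congruent modulo `I` to some `ρ u` of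
higher order. The map replacing `f` by `f - ∑ ρ u * lderWord u f` is unipotent, hence onto, and its
value at an `f` of order `N` is `∑ (u - ρ u) * lderWord u f`, which lies in `I`. -/
theorem tail_le_of_le_sup {I : Submodule k (NCSeries k n)} {N : ℕ}
    (hI : ∀ x ∈ I, ∀ y, x * y ∈ I) (h : tail k n N ≤ I ⊔ tail k n (N + 1)) :
    tail k n N ≤ I := by
  have hex : ∀ u : List (Fin n), ∃ ρ ∈ tail k n (N + 1), u.length = N → word k u - ρ ∈ I := by
    intro u
    by_cases hu : u.length = N
    · obtain ⟨x, hx, t, ht, e⟩ := Submodule.mem_sup.1 (h (hu ▸ word_mem_tail u))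
      exact ⟨t, ht, fun _ => by rwa [← e, add_sub_cancel_right]⟩
    · exact ⟨0, zero_mem _, fun h => absurd h hu⟩
  choose ρ hρ hρI using hex
  set W := (List.finite_length_eq (Fin n) N).toFinset
  let T : NCSeries k n →ₗ[k] NCSeries k n :=
    LinearMap.id - ∑ u ∈ W, LinearMap.mulLeft k (ρ u) ∘ₗ lderWord u
  have hT : ∀ f, T f = f - ∑ u ∈ W, ρ u * lderWord u f := fun f => by simp [T]
  have hTu : ∀ r, ∀ f ∈ tail k n r, T f - f ∈ tail k n (r + 1) := by
    intro r f hf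
    rw [hT, sub_sub_cancel_left]
    refine neg_mem (Submodule.sum_mem _ fun u hu => ?_)
    have hu' : u.length = N := by simpa [W] using hu
    have hl : lderWord u f ∈ tail k n (r - N) := fun w hw =>
      hf _ (by rw [List.length_append]; omega)
    exact tail_anti (by omega) (mul_mem_tail (hρ u) hl)
  intro g hg
  obtain ⟨f, rfl⟩ := (bijective_of_unipotent T hTu).2 g
  -- The preimage also has order at least `N`, because a unipotent map does not change leading
  -- terms.
  have hf : ∀ r ≤ N, f ∈ tail k n r := by
    intro r
    induction r with
    | zero => exact fun _ => mem_tail_zero f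
    | succ r ih =>
      intro hr
      have := sub_mem (tail_anti hr hg) (hTu r f (ih (by omega)))
      simpa using this
  rw [hT]
  nth_rewrite 1 [eq_sum_word_mul (hf N le_rfl)]
  rw [← Finset.sum_sub_distrib]
  refine Submodule.sum_mem _ fun u hu => ?_
  rw [← sub_mul]
  exact hI _ (hρI u (by simpa [W] using hu)) _

/-! ### The Jacobi ideal of a representative -/

/-- The Jacobi ideal as a subspace. -/
def jac (φ : NCSeries k n) : Submodule k (NCSeries k n) :=
  adicClosure (maxIdeal k n) (twoSidedSpan k (Set.range fun i => cyclicDer i φ))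

theorem mem_jac {φ x : NCSeries k n} : x ∈ jac φ ↔ x ∈ jacobiIdeal (proj φ) := Iff.rfl

theorem isAdicClosed_jac (φ : NCSeries k n) : IsAdicClosed (jac φ) :=
  isAdicClosed_adicClosure _

theorem jac_mul_left {φ : NCSeries k n} (a : NCSeries k n) {x : NCSeries k n} (hx : x ∈ jac φ) :
    a * x ∈ jac φ :=
  (jacobiIdeal (proj φ)).mul_mem_left a hx

theorem jac_mul_right {φ : NCSeries k n} {x : NCSeries k n} (hx : x ∈ jac φ) (a : NCSeries k n) :
    x * a ∈ jac φ :=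
  Ideal.mul_mem_right a (jacobiIdeal (proj φ)) hx

theorem twoSidedSpan_le {S : Set (NCSeries k n)} {U : Submodule k (NCSeries k n)}
    (hl : ∀ a, ∀ x ∈ U, a * x ∈ U) (hr : ∀ x ∈ U, ∀ a, x * a ∈ U) (hS : S ⊆ U) :
    twoSidedSpan k S ≤ U := by
  unfold twoSidedSpan
  refine Submodule.mul_le.2 fun x hx b _ => hr x ?_ b
  revert x
  exact Submodule.mul_le.2 fun a _ s hs => hl a s (Submodule.span_le.2 hS hs)

theorem subset_twoSidedSpan (S : Set (NCSeries k n)) : S ⊆ twoSidedSpan k S := by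
  intro s hs
  have h := Submodule.mul_mem_mul (Submodule.mul_mem_mul
    (Submodule.mem_top (R := k) (x := (1 : NCSeries k n)))
    (Submodule.subset_span (R := k) hs)) (Submodule.mem_top (R := k) (x := (1 : NCSeries k n)))
  simpa [twoSidedSpan] using h

theorem cyclicDer_mem_jac (φ : NCSeries k n) (i : Fin n) : cyclicDer i φ ∈ jac φ :=
  mem_adicClosure.2 fun _ => Submodule.mem_sup_left (subset_twoSidedSpan _ ⟨i, rfl⟩)

theorem jac_le {φ : NCSeries k n} {U : Submodule k (NCSeries k n)} (hU : IsAdicClosed U)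
    (hl : ∀ a, ∀ x ∈ U, a * x ∈ U) (hr : ∀ x ∈ U, ∀ a, x * a ∈ U)
    (hD : ∀ i, cyclicDer i φ ∈ U) : jac φ ≤ U := fun x hx =>
  hU x fun r => sup_le_sup_right
    (twoSidedSpan_le hl hr (by rintro _ ⟨i, rfl⟩; exact hD i)) _ (mem_adicClosure.1 hx r)

theorem isAdicClosed_tail (r : ℕ) : IsAdicClosed (tail k n r) := fun f hf => by
  simpa using hf r

theorem jac_le_tail {φ : NCSeries k n} {r : ℕ} (hφ : φ ∈ tail k n (r + 1)) :
    jac φ ≤ tail k n r :=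
  jac_le (isAdicClosed_tail r) (fun a _ hx => mul_mem_tail_left a hx)
    (fun _ hx a => mul_mem_tail_right a hx) (cyclicDer_mem_tail hφ)

theorem cyclicDer_eq_zero {f : NCSeries k n} (hf : f ∈ closedCommutators k n) (i : Fin n) :
    cyclicDer i f = 0 :=
  LinearMap.mem_ker.1 (closedCommutators_le_ker i hf)

/-- The images of the tails in `Λ` form a descending chain, which stabilizes at some `N`. Then `tail
k n N` lies in `jac φ ⊔ tail k n r` for every `r`, hence in the closed ideal `jac φ`. -/
theorem exists_tail_le_jac (φ : NCSeries k n)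
    (hfin : FiniteDimensional k (JacobiAlgebra (proj φ))) : ∃ N, tail k n N ≤ jac φ := by
  let c : ℕ →o (Submodule k (JacobiAlgebra (proj φ)))ᵒᵈ :=
    { toFun := fun r => OrderDual.toDual ((tail k n r).map (toJacobi (proj φ)).toLinearMap)
      monotone' := fun r s h => Submodule.map_mono (tail_anti h) }
  obtain ⟨N, hN⟩ := IsArtinian.monotone_stabilizes c
  refine ⟨N, fun f hf => isAdicClosed_jac φ f fun r => ?_⟩
  rcases le_total r N with h | h
  · exact Submodule.mem_sup_right (tail_anti h hf)
  · have e : (tail k n N).map (toJacobi (proj φ)).toLinearMap =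
        (tail k n r).map (toJacobi (proj φ)).toLinearMap := hN r h
    have hm : toJacobi (proj φ) f ∈ (tail k n N).map (toJacobi (proj φ)).toLinearMap :=
      ⟨f, hf, rfl⟩
    rw [e] at hm
    obtain ⟨g, hg, hgf⟩ := hm
    have : f - g ∈ jac φ := mem_jac.2 (Ideal.Quotient.eq.1 hgf.symm)
    rw [← sub_add_cancel f g]
    exact add_mem (Submodule.mem_sup_left this) (Submodule.mem_sup_right hg)

/-- By Nakayama the closure is superfluous, so elements of the Jacobi ideal are finite sums `∑ a *
D_i φ * b`. -/
theorem jac_eq_twoSidedSpan {φ : NCSeries k n} {N : ℕ} (hN : tail k n N ≤ jac φ) :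
    jac φ = twoSidedSpan k (Set.range fun i => cyclicDer i φ) := by
  have h : tail k n N ≤ twoSidedSpan k (Set.range fun i => cyclicDer i φ) :=
    tail_le_of_le_sup
      (fun x hx y => twoSidedSpan_mul_top _ (Submodule.mul_mem_mul hx Submodule.mem_top))
      fun x hx => mem_adicClosure.1 (hN hx) _
  refine le_antisymm (fun x hx => ?_) fun x hx => mem_adicClosure.2 fun _ =>
    Submodule.mem_sup_left hx
  exact sup_le le_rfl h (mem_adicClosure.1 hx N)

/-- By the chain rule each `D_i φ = D_i (G ψ)` lies in the image of `jac ψ` under `G`. The bound `N`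
is unchanged by the coordinate change, which later makes the set of possible weights finite. -/
theorem tail_le_jac_of_map (G : NCSeries k n ≃ₐ[k] NCSeries k n)
    (hG : ∀ i, G (X k i) ∈ tail k n 1) (hG' : ∀ i, G.symm (X k i) ∈ tail k n 1)
    {φ ψ : NCSeries k n} (h : G ψ - φ ∈ closedCommutators k n) {N : ℕ}
    (hN : tail k n N ≤ jac φ) : tail k n N ≤ jac ψ := by
  have hGt : ∀ {r f}, f ∈ tail k n r → G f ∈ tail k n r := fun {r f} hf =>
    map_mem_tail (G := (G : NCSeries k n →ₐ[k] NCSeries k n)) hG hf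
  have hGt' : ∀ {r f}, f ∈ tail k n r → G.symm f ∈ tail k n r := fun {r f} hf =>
    map_mem_tail (G := (G.symm : NCSeries k n →ₐ[k] NCSeries k n)) hG' hf
  let U : Submodule k (NCSeries k n) := (jac ψ).comap G.symm.toLinearMap
  have hUm : ∀ x, x ∈ U ↔ G.symm x ∈ jac ψ := fun x => Iff.rfl
  have hU : IsAdicClosed U := by
    intro f hf
    refine isAdicClosed_jac ψ _ fun r => ?_
    obtain ⟨x, hx, t, ht, e⟩ := Submodule.mem_sup.1 (hf r)
    have : G.symm f = G.symm x + G.symm t := by rw [← map_add, e]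
    change G.symm f ∈ _
    rw [this]
    exact add_mem (Submodule.mem_sup_left hx) (Submodule.mem_sup_right (hGt' ht))
  have hl : ∀ a, ∀ x ∈ U, a * x ∈ U := fun a x hx => by
    rw [hUm, map_mul]
    exact jac_mul_left _ hx
  have hr : ∀ x ∈ U, ∀ a, x * a ∈ U := fun x hx a => by
    rw [hUm, map_mul]
    exact jac_mul_right hx _
  have hD : ∀ i, cyclicDer i φ ∈ U := by
    intro i
    have e : cyclicDer i φ = cyclicDer i (G ψ) := by
      rw [eq_comm, ← sub_eq_zero, ← map_sub]
      exact cyclicDer_eq_zero h i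
    rw [e]
    have := cyclicDer_map (G := (G : NCSeries k n →ₐ[k] NCSeries k n)) hG i ψ
    rw [AlgEquiv.coe_toAlgHom] at this
    rw [this]
    refine Submodule.sum_mem _ fun l _ => pder_mem hU hl (fun f x hx => hr x hx f) _ _ ?_
    rw [hUm, G.symm_apply_apply]
    exact cyclicDer_mem_jac ψ l
  intro t ht
  have := jac_le hU hl hr hD (hN (hGt ht))
  rwa [hUm, G.symm_apply_apply] at this

/-! ### Quasi-homogeneity and derivations -/

theorem isQuasiHomogeneous_proj_iff (φ : NCSeries k n) :
    IsQuasiHomogeneous (proj φ) ↔ toJacobi (proj φ) φ ∈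
      adicClosure (jacobiMaxIdeal (proj φ)) (commutators k (JacobiAlgebra (proj φ))) := by
  exact Submodule.Quotient.mk_eq_zero
    (adicClosure (jacobiMaxIdeal (proj φ)) (commutators k (JacobiAlgebra (proj φ))))
    (x := toJacobi (proj φ) φ)

theorem isQuasiHomogeneous_of_isDer {φ : NCSeries k n} {ξ : NCSeries k n →ₗ[k] NCSeries k n}
    (hξ : IsDer ξ) (h : ξ φ - φ ∈ closedCommutators k n) : IsQuasiHomogeneous (proj φ) := by
  rw [isQuasiHomogeneous_proj_iff]
  have h1 := sub_mem (isDer_sub_sum_cyclicDer_mem hξ φ) h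
  set s := ∑ i, ξ (X k i) * cyclicDer i φ with hs
  have hsj : s ∈ jac φ := Submodule.sum_mem _ fun i _ => jac_mul_left _ (cyclicDer_mem_jac φ i)
  have e : toJacobi (proj φ) φ = toJacobi (proj φ) (ξ φ - s - (ξ φ - φ)) := by
    have h0 : toJacobi (proj φ) s = 0 := Ideal.Quotient.eq_zero_iff_mem.2 (mem_jac.1 hsj)
    have : ξ φ - s - (ξ φ - φ) = φ - s := by abel
    rw [this, map_sub, h0, sub_zero]
  rw [e]
  exact map_adicClosure_commutators (toJacobi (proj φ)) (maxIdeal k n) h1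

/-- Modulo commutators `a * D_i φ * b` becomes `b * a * D_i φ`, so right-hand factors can be
dropped. -/
theorem exists_sub_sum_mem_of_mem_twoSidedSpan (φ : NCSeries k n) {x : NCSeries k n}
    (hx : x ∈ twoSidedSpan k (Set.range fun i => cyclicDer i φ)) :
    ∃ f : Fin n → NCSeries k n, x - ∑ i, f i * cyclicDer i φ ∈ closedCommutators k n := by
  let P : (Fin n → NCSeries k n) →ₗ[k] NCSeries k n :=
    ∑ i, LinearMap.mulRight k (cyclicDer i φ) ∘ₗ LinearMap.proj i
  have hP : ∀ f, P f = ∑ i, f i * cyclicDer i φ := fun f => by simp [P]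
  have hleft : ∀ a, ∀ s ∈ Submodule.span k (Set.range fun i => cyclicDer i φ),
      a * s ∈ LinearMap.range P := by
    intro a
    change _ ≤ (LinearMap.range P).comap (LinearMap.mulLeft k a)
    rw [Submodule.span_le]
    rintro _ ⟨i, rfl⟩
    refine ⟨Pi.single i a, ?_⟩
    rw [hP, Finset.sum_eq_single i]
    · simp
    · intro j _ hj
      simp [hj]
    · simp
  suffices h : twoSidedSpan k (Set.range fun i => cyclicDer i φ) ≤
      LinearMap.range P ⊔ closedCommutators k n by
    obtain ⟨_, ⟨f, rfl⟩, c, hc, rfl⟩ := Submodule.mem_sup.1 (h hx)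
    exact ⟨f, by rw [← hP, add_sub_cancel_left]; exact hc⟩
  unfold twoSidedSpan
  refine Submodule.mul_le.2 fun x hx b _ => ?_
  rw [← sub_add_cancel (x * b) (b * x)]
  refine add_mem (Submodule.mem_sup_right (mul_sub_mul_mem x b)) (Submodule.mem_sup_left ?_)
  suffices h : ⊤ * Submodule.span k (Set.range fun i => cyclicDer i φ) ≤
      (LinearMap.range P).comap (LinearMap.mulLeft k b) from h hx
  refine Submodule.mul_le.2 fun a _ s hs => ?_
  rw [Submodule.mem_comap, LinearMap.mulLeft_apply, ← mul_assoc]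
  exact hleft _ s hs

theorem commutators_le_map {A B : Type*} [Ring A] [Algebra k A] [Ring B] [Algebra k B]
    (g : A →ₐ[k] B) (hg : Function.Surjective g) :
    commutators k B ≤ (commutators k A).map g.toLinearMap := by
  rw [commutators, Submodule.span_le]
  rintro _ ⟨a, b, rfl⟩
  obtain ⟨a, rfl⟩ := hg a
  obtain ⟨b, rfl⟩ := hg b
  exact ⟨a * b - b * a, Submodule.subset_span ⟨a, b, rfl⟩, by simp⟩

/-- Lifting the commutators from `Λ` to `F` puts `φ` in the Jacobi ideal modulo commutators, thus `φ
≡ ∑ f i * D_i φ`; the derivation with `ξ(x_i) = f i` then fixes `φ`. -/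
theorem exists_isDer_of_isQuasiHomogeneous {φ : NCSeries k n} {N : ℕ}
    (hN : tail k n N ≤ jac φ) (h : IsQuasiHomogeneous (proj φ)) :
    ∃ ξ : NCSeries k n →ₗ[k] NCSeries k n, IsDer ξ ∧ ξ φ - φ ∈ closedCommutators k n := by
  rw [isQuasiHomogeneous_proj_iff] at h
  -- At level `N` the error term comes from `tail k n (N + 1)`, which vanishes in `Λ`.
  have h1 := (Submodule.mem_iInf _).1 h N
  rw [jacobiMaxIdeal, ← Submodule.map_pow, maxIdeal_pow_succ] at h1
  obtain ⟨c', hc', _, ⟨t, ht, rfl⟩, e⟩ := Submodule.mem_sup.1 h1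
  obtain ⟨c, hc, rfl⟩ := commutators_le_map (toJacobi (proj φ))
    (Ideal.Quotient.mkₐ_surjective k _) hc'
  have ht0 : toJacobi (proj φ) t = 0 :=
    Ideal.Quotient.eq_zero_iff_mem.2 (mem_jac.1 (hN (tail_anti (Nat.le_succ N) ht)))
  have hd : φ - c ∈ jac φ := by
    rw [mem_jac, ← Ideal.Quotient.eq_zero_iff_mem]
    change toJacobi (proj φ) (φ - c) = 0
    rw [map_sub, ← e]
    change toJacobi (proj φ) c + toJacobi (proj φ) t - toJacobi (proj φ) c = 0
    rw [ht0, add_zero, sub_self]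
  rw [jac_eq_twoSidedSpan hN] at hd
  obtain ⟨f, hf⟩ := exists_sub_sum_mem_of_mem_twoSidedSpan φ hd
  obtain ⟨ξ, hξ, hx⟩ := exists_isDer f
  refine ⟨ξ, hξ, ?_⟩
  have h2 := isDer_sub_sum_cyclicDer_mem hξ φ
  simp only [hx] at h2
  have h3 := sub_mem (sub_mem h2 hf) (commutators_le_adicClosure (maxIdeal k n) hc)
  convert h3 using 1
  abel

/-- Since `D_i (ξ φ) = D_i φ`, the commutation rule expresses `ξ (D_i φ)` through double derivatives
evaluated at the `D_l φ`, which stay in the ideal. -/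
theorem map_jac_of_isDer {φ : NCSeries k n} {ξ : NCSeries k n →ₗ[k] NCSeries k n} (hξ : IsDer ξ)
    (h : ξ φ - φ ∈ closedCommutators k n) {x : NCSeries k n} (hx : x ∈ jac φ) : ξ x ∈ jac φ := by
  suffices hle : jac φ ≤ jac φ ⊓ (jac φ).comap ξ from (hle hx).2
  refine jac_le ?_ ?_ ?_ ?_
  · intro f hf
    refine ⟨isAdicClosed_jac φ f fun r =>
      (sup_le_sup_right inf_le_left _ : _ ≤ jac φ ⊔ tail k n r) (hf r), ?_⟩
    refine isAdicClosed_jac φ _ fun r => ?_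
    obtain ⟨y, hy, t, ht, rfl⟩ := Submodule.mem_sup.1 (hf (r + 1))
    rw [map_add]
    exact add_mem (Submodule.mem_sup_left hy.2) (Submodule.mem_sup_right (hξ.map_tail_succ ht))
  · intro a y hy
    refine ⟨jac_mul_left a hy.1, ?_⟩
    rw [SetLike.mem_coe, Submodule.mem_comap, hξ]
    exact add_mem (jac_mul_left _ hy.1) (jac_mul_left _ hy.2)
  · intro y hy a
    refine ⟨jac_mul_right hy.1 a, ?_⟩
    rw [SetLike.mem_coe, Submodule.mem_comap, hξ]
    exact add_mem (jac_mul_right hy.2 _) (jac_mul_right hy.1 _)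
  · intro i
    refine ⟨cyclicDer_mem_jac φ i, ?_⟩
    have e := cyclicDer_isDer hξ i φ
    have e2 : cyclicDer i (ξ φ) = cyclicDer i φ := by
      rw [← sub_eq_zero, ← map_sub]
      exact cyclicDer_eq_zero h i
    rw [SetLike.mem_coe, Submodule.mem_comap, ← sub_eq_iff_eq_add.2 e, e2]
    exact sub_mem (cyclicDer_mem_jac φ i) (Submodule.sum_mem _ fun l _ =>
      pder_mem (isAdicClosed_jac φ) (fun f _ hx => jac_mul_left f hx)
        (fun f _ hx => jac_mul_right hx f) _ _ (cyclicDer_mem_jac φ l))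

theorem isDer_X_pow {ξ : NCSeries k n →ₗ[k] NCSeries k n} (hξ : IsDer ξ) (i : Fin n) (j : ℕ) :
    ξ (X k i ^ (j + 1)) - (((j : k) + 1) * ξ (X k i) []) • X k i ^ j ∈ tail k n (j + 1) := by
  have hp : ∀ j, X k i ^ j ∈ tail k n j := by
    intro j
    induction j with
    | zero => exact mem_tail_zero _
    | succ j ih => rw [pow_succ]; exact mul_mem_tail ih (X_mem_tail i)
  have h0 : ξ (X k i) - ξ (X k i) [] • (1 : NCSeries k n) ∈ tail k n 1 := by
    intro w hw
    obtain rfl : w = [] := List.length_eq_zero_iff.1 (by omega)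
    rw [NCSeries.sub_apply, smul_one_apply, if_pos rfl, sub_self]
  induction j with
  | zero => simpa using h0
  | succ j ih =>
    rw [pow_succ, hξ]
    have := add_mem (mul_mem_tail ih (X_mem_tail i)) (mul_mem_tail (hp (j + 1)) h0)
    convert this using 1
    rw [sub_mul, mul_sub, smul_mul_assoc, mul_smul_comm, mul_one, ← pow_succ]
    push_cast
    simp only [add_mul, add_smul, one_mul]
    abel

/-- A derivation that fixes a superpotential of order at least two with finite dimensional
Jacobi algebra preserves the maximal ideal. -/
theorem isDer_X_mem_tail [CharZero k] {φ : NCSeries k n} {N : ℕ} (hφ : φ ∈ tail k n 2)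
    (hN : tail k n N ≤ jac φ) {ξ : NCSeries k n →ₗ[k] NCSeries k n} (hξ : IsDer ξ)
    (h : ξ φ - φ ∈ closedCommutators k n) (i : Fin n) : ξ (X k i) ∈ tail k n 1 := by
  suffices hc : ξ (X k i) [] = 0 by
    intro w hw
    obtain rfl : w = [] := List.length_eq_zero_iff.1 (by omega)
    exact hc
  by_contra hc
  -- A nonzero constant term of `ξ(x_i)` makes `ξ` send `x_i ^ (j + 1)` to a nonzero multiple of
  -- `x_i ^ j` plus higher order (characteristic zero), while `ξ` preserves the Jacobi ideal.
  -- Descending from `x_i ^ N` reaches `1`.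
  have hstep : ∀ j, X k i ^ (j + 1) ∈ jac φ ⊔ tail k n (j + 2) →
      X k i ^ j ∈ jac φ ⊔ tail k n (j + 1) := by
    intro j hj
    obtain ⟨y, hy, t, ht, e⟩ := Submodule.mem_sup.1 hj
    have hne : ((j : k) + 1) * ξ (X k i) [] ≠ 0 := mul_ne_zero (Nat.cast_add_one_ne_zero j) hc
    rw [← Submodule.smul_mem_iff _ hne]
    have h1 : ξ (X k i ^ (j + 1)) ∈ jac φ ⊔ tail k n (j + 1) := by
      rw [← e, map_add]
      exact add_mem (Submodule.mem_sup_left (map_jac_of_isDer hξ h hy))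
        (Submodule.mem_sup_right (hξ.map_tail_succ ht))
    have := sub_mem h1 (Submodule.mem_sup_right (S := jac φ) (isDer_X_pow hξ i j))
    rwa [sub_sub_cancel] at this
  have hall : ∀ j, X k i ^ j ∈ jac φ ⊔ tail k n (j + 1) → (1 : NCSeries k n) ∈
      jac φ ⊔ tail k n 1 := by
    intro j
    induction j with
    | zero => simp
    | succ j ih => exact fun hj => ih (hstep j hj)
  have hp : ∀ j, X k i ^ j ∈ tail k n j := by
    intro j
    induction j with
    | zero => exact mem_tail_zero _
    | succ j ih => rw [pow_succ]; exact mul_mem_tail ih (X_mem_tail i)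
  have h1 := sup_le (jac_le_tail (r := 1) hφ) le_rfl
    (hall N (Submodule.mem_sup_left (hN (hp N)))) [] (by simp)
  simp [NCSeries.one_apply] at h1

theorem exists_mem_tail_of_le_order {Φ : Superpotential k n} {r : ℕ} (h : r + 1 ≤ order Φ) :
    ∃ φ ∈ tail k n (r + 1), proj φ = Φ := by
  by_contra hne
  have hle : order Φ ≤ r := by
    refine iSup₂_le fun s hs => ?_
    by_contra hlt
    have hlt' : r + 1 ≤ s := by
      have : (r : ℕ∞) < s := not_le.1 hlt
      exact_mod_cast this
    obtain ⟨s, rfl⟩ : ∃ t, s = t + 1 := ⟨s - 1, by omega⟩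
    rw [maxIdeal_pow_succ] at hs
    obtain ⟨φ, hφ, e⟩ := hs
    exact hne ⟨φ, tail_anti hlt' hφ, e⟩
  have := h.trans hle
  norm_cast at this
  omega

end Jacobi

/-! ### Weight decomposition by topological generalized eigenvectors. -/

section Eigen

variable {k : Type u} [Field k] {n : ℕ}

open NCSeries

/-! ### Topological generalized eigenvectors -/

/-- `f` is a topological generalized eigenvector of `ξ`: its image in each quotient by a term of
the order filtration is a generalized eigenvector. -/
def IsGenEigen (ξ : Module.End k (NCSeries k n)) (μ : k) (f : NCSeries k n) : Prop :=
  ∀ r, ∃ p : ℕ, ((ξ - μ • 1) ^ p : Module.End k (NCSeries k n)) f ∈ tail k n r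

theorem pow_apply_mem_tail {ξ : Module.End k (NCSeries k n)}
    (hξ : ∀ r, ∀ f ∈ tail k n r, ξ f ∈ tail k n r) (μ : k) (p : ℕ) {r : ℕ} {f : NCSeries k n}
    (hf : f ∈ tail k n r) : ((ξ - μ • 1) ^ p) f ∈ tail k n r := by
  induction p with
  | zero => simpa using hf
  | succ p ih =>
    rw [pow_succ', Module.End.mul_apply]
    exact sub_mem (hξ r _ ih) (Submodule.smul_mem _ μ ih)

/-- By Leibniz, `ξ - (μ + ν)` acts on `f * g` as `ξ - μ` on `f` plus `ξ - ν` on `g`. After `p + q`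
applications one factor has been hit often enough. -/
theorem pow_apply_mul_mem_tail {ξ : Module.End k (NCSeries k n)} (hd : IsDer ξ)
    (hξ : ∀ r, ∀ f ∈ tail k n r, ξ f ∈ tail k n r) (μ ν : k) (r p q : ℕ) (f g : NCSeries k n)
    (hf : ((ξ - μ • 1) ^ p) f ∈ tail k n r) (hg : ((ξ - ν • 1) ^ q) g ∈ tail k n r) :
    ((ξ - (μ + ν) • 1) ^ (p + q)) (f * g) ∈ tail k n r := by
  induction p generalizing f g q with
  | zero => exact pow_apply_mem_tail hξ _ _ (mul_mem_tail_right _ (by simpa using hf))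
  | succ p ihp =>
    induction q generalizing f g with
    | zero => exact pow_apply_mem_tail hξ _ _ (mul_mem_tail_left _ (by simpa using hg))
    | succ q ihq =>
      have e : (ξ - (μ + ν) • 1) (f * g) =
          (ξ - μ • 1 : Module.End k (NCSeries k n)) f * g +
            f * (ξ - ν • 1 : Module.End k (NCSeries k n)) g := by
        simp only [LinearMap.sub_apply, LinearMap.smul_apply, Module.End.one_apply, sub_mul,
          mul_sub, add_smul, LinearMap.add_apply, smul_mul_assoc, mul_smul_comm]
        rw [hd]
        abel
      rw [← add_assoc, pow_succ, Module.End.mul_apply, e, map_add]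
      refine add_mem ?_ ?_
      · rw [show p + 1 + q = p + (q + 1) by omega]
        exact ihp (q + 1) _ _ (by rwa [pow_succ, Module.End.mul_apply] at hf) hg
      · exact ihq _ _ hf (by rwa [pow_succ, Module.End.mul_apply] at hg)

theorem isGenEigen_word {ξ : Module.End k (NCSeries k n)} (hd : IsDer ξ)
    (hξ : ∀ r, ∀ f ∈ tail k n r, ξ f ∈ tail k n r) {l : Fin n → k}
    (hl : ∀ i, IsGenEigen ξ (l i) (X k i)) (w : List (Fin n)) :
    IsGenEigen ξ (w.map l).sum (word k w) := by
  intro r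
  induction w with
  | nil => exact ⟨1, by simp [word_nil, hd.map_one]⟩
  | cons i w ih =>
    obtain ⟨p, hp⟩ := hl i r
    obtain ⟨q, hq⟩ := ih
    rw [List.map_cons, List.sum_cons, word_cons]
    exact ⟨p + q, pow_apply_mul_mem_tail hd hξ _ _ r p q _ _ hp hq⟩

/-- The part of a series supported on words of weight one. -/
def weightPart (l : Fin n → k) : NCSeries k n →ₗ[k] NCSeries k n :=
  letI := Classical.decEq k
  { toFun := fun f w => if (w.map l).sum = 1 then f w else 0
    map_add' := fun f g => by
      ext w
      change (if _ then f w + g w else 0) = (if _ then f w else 0) + (if _ then g w else 0)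
      split_ifs
      · rfl
      · rw [add_zero]
    map_smul' := fun c f => by
      ext w
      change (if _ then c * f w else 0) = c * (if _ then f w else 0)
      split_ifs
      · rfl
      · rw [mul_zero] }

theorem weightPart_apply_of_eq {l : Fin n → k} {w : List (Fin n)} (h : (w.map l).sum = 1)
    (f : NCSeries k n) : weightPart l f w = f w := if_pos h

theorem weightPart_apply_of_ne {l : Fin n → k} {w : List (Fin n)} (h : (w.map l).sum ≠ 1)
    (f : NCSeries k n) : weightPart l f w = 0 := if_neg h

theorem weightPart_mem_tail (l : Fin n → k) {r : ℕ} {f : NCSeries k n} (hf : f ∈ tail k n r) :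
    weightPart l f ∈ tail k n r := by
  intro w hw
  by_cases h : (w.map l).sum = 1
  · rw [weightPart_apply_of_eq h, hf w hw]
  · rw [weightPart_apply_of_ne h]

theorem weightPart_word_of_eq {l : Fin n → k} {w : List (Fin n)} (h : (w.map l).sum = 1) :
    weightPart l (word k w) = word k w := by
  ext v
  by_cases hv : v = w
  · rw [hv, weightPart_apply_of_eq h]
  · by_cases h' : (v.map l).sum = 1
    · rw [weightPart_apply_of_eq h']
    · rw [weightPart_apply_of_ne h', word, if_neg hv]

theorem weightPart_word_of_ne {l : Fin n → k} {w : List (Fin n)} (h : (w.map l).sum ≠ 1) :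
    weightPart l (word k w) = 0 := by
  ext v
  by_cases h' : (v.map l).sum = 1
  · rw [weightPart_apply_of_eq h', word, if_neg (by rintro rfl; exact h h')]
    rfl
  · rw [weightPart_apply_of_ne h']
    rfl

theorem mapQ_pow_apply {V : Type*} [AddCommGroup V] [Module k V] (ξ : Module.End k V)
    (U : Submodule k V) (hU : U ≤ U.comap ξ) (μ : k) (p : ℕ) (x : V) :
    (((U.mapQ U ξ hU : Module.End k (V ⧸ U)) - μ • 1) ^ p) (U.mkQ x) =
      U.mkQ (((ξ - μ • 1) ^ p) x) := by
  induction p with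
  | zero => rfl
  | succ p ih =>
    rw [pow_succ', pow_succ', Module.End.mul_apply, Module.End.mul_apply, ih]
    rfl

/-- If the variables are generalized eigenvectors of a derivation that fixes `ψ` up to
commutators, then `ψ` agrees with its part of weight one up to commutators. -/
theorem sub_weightPart_mem {ξ : Module.End k (NCSeries k n)} (hd : IsDer ξ)
    (hξ : ∀ r, ∀ f ∈ tail k n r, ξ f ∈ tail k n r) {l : Fin n → k}
    (hl : ∀ i, IsGenEigen ξ (l i) (X k i)) {ψ : NCSeries k n}
    (hψ : ξ ψ - ψ ∈ closedCommutators k n) :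
    ψ - weightPart l ψ ∈ closedCommutators k n := by
  refine mem_adicClosure.2 fun r => ?_
  -- Modulo `U` the class of `ψ` is an eigenvector for `1`, while every word is a generalized
  -- eigenvector for its weight; independence of generalized eigenspaces removes the words of other
  -- weights.
  set U : Submodule k (NCSeries k n) := commutators k (NCSeries k n) ⊔ tail k n r with hUdef
  have hU : U ≤ U.comap ξ := by
    refine sup_le (hd.map_commutators.trans (Submodule.comap_mono le_sup_left)) fun f hf => ?_
    exact Submodule.mem_sup_right (hξ r f hf)
  set T : Module.End k (NCSeries k n ⧸ U) := U.mapQ U ξ hU with hT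
  have htail : ∀ t ∈ tail k n r, U.mkQ t = 0 := fun t ht =>
    (Submodule.Quotient.mk_eq_zero U).2 (Submodule.mem_sup_right ht)
  have hword : ∀ w : List (Fin n),
      U.mkQ (word k w) ∈ T.maxGenEigenspace (w.map l).sum := by
    intro w
    obtain ⟨p, hp⟩ := isGenEigen_word hd hξ hl w r
    rw [Module.End.mem_maxGenEigenspace]
    exact ⟨p, by rw [hT, mapQ_pow_apply, htail _ hp]⟩
  have hdense : ∀ (S : NCSeries k n →ₗ[k] NCSeries k n) (M : Submodule k (NCSeries k n ⧸ U)),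
      (∀ t ∈ tail k n r, S t ∈ tail k n r) → (∀ w, U.mkQ (S (word k w)) ∈ M) →
      ∀ f, U.mkQ (S f) ∈ M := by
    intro S M hS hw f
    obtain ⟨p, hp, hpt⟩ := exists_polynomial f r
    have hle : Submodule.span k (Set.range (word k (n := n))) ≤ M.comap (U.mkQ ∘ₗ S) := by
      rw [Submodule.span_le]
      rintro _ ⟨w, rfl⟩
      exact hw w
    have e : S f = S p + S (f - p) := by rw [← map_add]; simp
    rw [e, map_add, htail _ (hS _ hpt), add_zero]
    exact hle hp
  have h1 : U.mkQ (weightPart l ψ) ∈ T.maxGenEigenspace 1 := by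
    refine hdense _ _ (fun t ht => weightPart_mem_tail l ht) (fun w => ?_) ψ
    by_cases h : (w.map l).sum = 1
    · rw [weightPart_word_of_eq h, ← h]
      exact hword w
    · rw [weightPart_word_of_ne h, map_zero]
      exact zero_mem _
  have h2 : U.mkQ (ψ - weightPart l ψ) ∈ ⨆ μ ≠ 1, T.maxGenEigenspace μ := by
    refine hdense (LinearMap.id - weightPart l) _
      (fun t ht => sub_mem ht (weightPart_mem_tail l ht)) (fun w => ?_) ψ
    rw [LinearMap.sub_apply, LinearMap.id_apply]
    by_cases h : (w.map l).sum = 1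
    · rw [weightPart_word_of_eq h, sub_self, map_zero]
      exact zero_mem _
    · rw [weightPart_word_of_ne h, sub_zero]
      exact Submodule.mem_iSup_of_mem _ (Submodule.mem_iSup_of_mem h (hword w))
  have h3 : U.mkQ ψ ∈ T.maxGenEigenspace 1 := by
    rw [Module.End.mem_maxGenEigenspace]
    refine ⟨1, ?_⟩
    rw [hT, mapQ_pow_apply, pow_one, one_smul]
    exact (Submodule.Quotient.mk_eq_zero U).2 (mem_adicClosure.1 hψ r)
  have h4 : U.mkQ (ψ - weightPart l ψ) ∈ T.maxGenEigenspace 1 := by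
    rw [map_sub]
    exact sub_mem h3 h1
  have h5 := Submodule.disjoint_def.1 (T.independent_maxGenEigenspace 1) _ h4 h2
  exact (Submodule.Quotient.mk_eq_zero U).1 h5

instance finiteDimensional_quotient_tail (r : ℕ) :
    FiniteDimensional k (NCSeries k n ⧸ tail k n r) := by
  have : Finite {w : List (Fin n) | w.length < r} := List.finite_length_lt (Fin n) r
  let c : NCSeries k n →ₗ[k] ({w : List (Fin n) | w.length < r} → k) :=
    { toFun := fun f w => f w.1
      map_add' := fun _ _ => rfl
      map_smul' := fun _ _ => rfl }
  have hc : tail k n r = LinearMap.ker c := by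
    ext f
    rw [LinearMap.mem_ker]
    exact ⟨fun h => funext fun w => h w.1 w.2, fun h w hw => congrFun h ⟨w, hw⟩⟩
  rw [hc]
  exact Module.Finite.equiv c.quotKerEquivRange.symm

/-- A Fitting argument with `D = ξ - μ`: modulo `tail k n (r + 1)` the images of `tail k n r` under
the powers of `D` stabilize, say from `q` on. Thus `D ^ (q + p) y = D ^ q (D ^ p y)` equals `D ^ (q
+ p) v` there for some `v` of order `r`, and `y - v` is the corrected element. -/
theorem exists_genEigen_step {ξ : Module.End k (NCSeries k n)}
    (hξ : ∀ r, ∀ f ∈ tail k n r, ξ f ∈ tail k n r) (μ : k) (r : ℕ) (y : NCSeries k n)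
    (hy : ∃ p : ℕ, ((ξ - μ • 1) ^ p : Module.End k (NCSeries k n)) y ∈ tail k n r) :
    ∃ z, (∃ p : ℕ, ((ξ - μ • 1) ^ p : Module.End k (NCSeries k n)) z ∈ tail k n (r + 1)) ∧ z - y ∈ tail k n r := by
  obtain ⟨p, hp⟩ := hy
  set D : Module.End k (NCSeries k n) := ξ - μ • 1
  have hanti : Antitone fun q : ℕ => (tail k n r).map ((tail k n (r + 1)).mkQ ∘ₗ D ^ q) := by
    refine antitone_nat_of_succ_le fun q => ?_
    rintro _ ⟨f, hf, rfl⟩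
    refine ⟨D f, ?_, ?_⟩
    · have := pow_apply_mem_tail hξ μ 1 hf
      rwa [pow_one] at this
    · rw [LinearMap.comp_apply, LinearMap.comp_apply, pow_succ, Module.End.mul_apply]
  obtain ⟨q, hq⟩ := IsArtinian.monotone_stabilizes
    (⟨fun q => OrderDual.toDual ((tail k n r).map ((tail k n (r + 1)).mkQ ∘ₗ D ^ q)),
      fun a b h => hanti h⟩ :
      ℕ →o (Submodule k (NCSeries k n ⧸ tail k n (r + 1)))ᵒᵈ)
  have e : (tail k n r).map ((tail k n (r + 1)).mkQ ∘ₗ D ^ q) =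
    (tail k n r).map ((tail k n (r + 1)).mkQ ∘ₗ D ^ (q + p)) := hq (q + p) (by omega)
  have hm : (tail k n (r + 1)).mkQ ((D ^ (q + p)) y) ∈
      (tail k n r).map ((tail k n (r + 1)).mkQ ∘ₗ D ^ q) :=
    ⟨(D ^ p) y, hp, by rw [pow_add, Module.End.mul_apply, LinearMap.comp_apply]⟩
  rw [e] at hm
  obtain ⟨v, hv, hvy⟩ := hm
  refine ⟨y - v, ⟨q + p, ?_⟩, ?_⟩
  · rw [map_sub]
    exact (Submodule.Quotient.eq _).1 hvy.symm
  · rw [sub_sub_cancel_left]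
    exact neg_mem hv

theorem exists_isGenEigen {ξ : Module.End k (NCSeries k n)}
    (hξ : ∀ r, ∀ f ∈ tail k n r, ξ f ∈ tail k n r) (μ : k) (r : ℕ) (y : NCSeries k n)
    (hy : ∃ p : ℕ, ((ξ - μ • 1) ^ p : Module.End k (NCSeries k n)) y ∈ tail k n r) :
    ∃ z, IsGenEigen ξ μ z ∧ z - y ∈ tail k n r := by
  let P : ℕ → NCSeries k n → Prop := fun j z => ∃ p : ℕ, ((ξ - μ • 1) ^ p : Module.End k (NCSeries k n)) z ∈ tail k n (r + j)
  have hstep : ∀ j (x : {x // P j x}), ∃ z : {z // P (j + 1) z}, z.1 - x.1 ∈ tail k n (r + j) := by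
    rintro j ⟨x, hx⟩
    obtain ⟨z, hz, hzx⟩ := exists_genEigen_step hξ μ (r + j) x hx
    exact ⟨⟨z, hz⟩, hzx⟩
  choose g hg using hstep
  let s : ∀ j, {z // P j z} := fun j => Nat.rec ⟨y, hy⟩ g j
  have hs : ∀ j, (s (j + 1)).1 - (s j).1 ∈ tail k n (r + j) := fun j => hg j (s j)
  -- Truncated subtraction keeps the sequence constant up to index `r`, matching the orders that
  -- `exists_limit` expects.
  obtain ⟨f, hf⟩ := exists_limit (fun j => (s (j - r)).1) (by
    intro j
    by_cases hj : r ≤ j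
    · have h1 : j + 1 - r = j - r + 1 := by omega
      rw [h1]
      exact tail_anti (by omega) (hs (j - r))
    · have h1 : j + 1 - r = 0 := by omega
      have h2 : j - r = 0 := by omega
      rw [h1, h2, sub_self]
      exact zero_mem _)
  have hf' : ∀ j, f - (s j).1 ∈ tail k n (r + j) := by
    intro j
    have := hf (r + j)
    rwa [Nat.add_sub_cancel_left] at this
  refine ⟨f, fun j => ?_, hf' 0⟩
  obtain ⟨p, hp⟩ := (s j).2
  refine ⟨p, tail_anti (Nat.le_add_left j r) ?_⟩
  have := add_mem (pow_apply_mem_tail hξ μ p (hf' j)) hp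
  rwa [← map_add, sub_add_cancel] at this

end Eigen

/-! ### Linear parts, coordinate changes, and the normal form. -/

section LinearParts

variable {k : Type u} [Field k] {n : ℕ}

open NCSeries

/-! ### Linear parts -/

/-- The coefficients of the variables. -/
def lin : NCSeries k n →ₗ[k] (Fin n → k) where
  toFun f i := f [i]
  map_add' _ _ := rfl
  map_smul' _ _ := rfl

/-- The linear form with given coefficients. -/
def ofLin : (Fin n → k) →ₗ[k] NCSeries k n := Fintype.linearCombination k (X k)

theorem ofLin_apply (v : Fin n → k) : ofLin v = ∑ i, v i • X k i :=
  Fintype.linearCombination_apply k (X k) v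

theorem lin_apply (f : NCSeries k n) (i : Fin n) : lin f i = f [i] := rfl

theorem lin_X (i : Fin n) : lin (X k i) = Pi.single i 1 := by
  ext j
  rw [lin_apply, Pi.single_apply]
  simp [X, word]

theorem lin_ofLin (v : Fin n → k) : lin (ofLin v) = v := by
  rw [ofLin_apply, map_sum]
  ext j
  simp [lin_X, Pi.single_apply]

theorem lin_eq_zero {f : NCSeries k n} (hf : f ∈ tail k n 2) : lin f = 0 :=
  funext fun i => hf [i] (by simp)

theorem mem_tail_two {f : NCSeries k n} (hf : f ∈ tail k n 1) (h : lin f = 0) :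
    f ∈ tail k n 2 := by
  intro w hw
  rcases w with _ | ⟨i, w⟩
  · exact hf [] (by simp)
  · obtain rfl : w = [] := List.length_eq_zero_iff.1 (by simpa using hw)
    exact congrFun h i

theorem ofLin_mem_tail (v : Fin n → k) : ofLin v ∈ tail k n 1 := by
  rw [ofLin_apply]
  exact Submodule.sum_mem _ fun i _ => Submodule.smul_mem _ _ (X_mem_tail i)

theorem sub_ofLin_mem_tail {f : NCSeries k n} (hf : f ∈ tail k n 1) :
    f - ofLin (lin f) ∈ tail k n 2 :=
  mem_tail_two (sub_mem hf (ofLin_mem_tail _)) (by rw [map_sub, lin_ofLin, sub_self])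

/-- The linear part of an endomorphism. -/
def linPart : (NCSeries k n →ₗ[k] NCSeries k n) →ₗ[k] Module.End k (Fin n → k) where
  toFun ξ := lin ∘ₗ ξ ∘ₗ ofLin
  map_add' _ _ := by ext; simp
  map_smul' _ _ := by ext; simp

theorem linPart_apply (ξ : NCSeries k n →ₗ[k] NCSeries k n) (v : Fin n → k) :
    linPart ξ v = lin (ξ (ofLin v)) := rfl

theorem linPart_lin {ξ : NCSeries k n →ₗ[k] NCSeries k n}
    (hξ : ∀ r, ∀ f ∈ tail k n r, ξ f ∈ tail k n r) {f : NCSeries k n} (hf : f ∈ tail k n 1) :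
    linPart ξ (lin f) = lin (ξ f) := by
  rw [linPart_apply, ← sub_eq_zero, ← map_sub, ← map_sub, ← neg_sub, map_neg, map_neg,
    lin_eq_zero (hξ 2 _ (sub_ofLin_mem_tail hf)), neg_zero]

theorem linPart_pow_lin {ξ : Module.End k (NCSeries k n)}
    (hξ : ∀ r, ∀ f ∈ tail k n r, ξ f ∈ tail k n r) (μ : k) (p : ℕ) {f : NCSeries k n}
    (hf : f ∈ tail k n 1) :
    ((linPart ξ - μ • 1 : Module.End k (Fin n → k)) ^ p) (lin f) =
      lin (((ξ - μ • 1 : Module.End k (NCSeries k n)) ^ p) f) := by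
  induction p with
  | zero => rfl
  | succ p ih =>
    rw [pow_succ', pow_succ', Module.End.mul_apply, Module.End.mul_apply, ih,
      LinearMap.sub_apply, LinearMap.sub_apply, map_sub,
      linPart_lin hξ (pow_apply_mem_tail hξ μ p hf)]
    rfl

/-! ### Automorphisms -/

/-- Induct on the order via `K(x g) - x g = (K x - x) K g + x (K g - g)`. -/
theorem sub_mem_tail_of_unipotent {K : NCSeries k n →ₐ[k] NCSeries k n}
    (hK : ∀ i, K (X k i) - X k i ∈ tail k n 2) (r : ℕ) (f : NCSeries k n)
    (hf : f ∈ tail k n r) : K f - f ∈ tail k n (r + 1) := by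
  have hK1 : ∀ i, K (X k i) ∈ tail k n 1 := fun i => by
    have := add_mem (tail_anti (by omega) (hK i)) (X_mem_tail (k := k) i)
    rwa [sub_add_cancel] at this
  -- For `s = 0` the truncated `s - 1` is `0`; this case handles series after removal of their
  -- constant term.
  have key : ∀ s, ∀ f ∈ tail k n 1, (∀ i, K (lder i f) - lder i f ∈ tail k n s) →
      (∀ i, lder i f ∈ tail k n (s - 1)) → K f - f ∈ tail k n (s + 1) := by
    intro s f hf h1 h2
    have e : K f - f = ∑ i, ((K (X k i) - X k i) * K (lder i f) +
        X k i * (K (lder i f) - lder i f)) := by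
      nth_rewrite 1 2 [eq_sum_of_mem_tail hf]
      rw [map_sum, ← Finset.sum_sub_distrib]
      refine Finset.sum_congr rfl fun i _ => ?_
      rw [map_mul, sub_mul, mul_sub]
      abel
    rw [e]
    refine Submodule.sum_mem _ fun i _ => add_mem ?_ ?_
    · exact tail_anti (by omega) (mul_mem_tail (hK i) (map_mem_tail hK1 (h2 i)))
    · rw [add_comm s 1]
      exact mul_mem_tail (X_mem_tail i) (h1 i)
  induction r generalizing f with
  | zero =>
    have hg : f - f [] • (1 : NCSeries k n) ∈ tail k n 1 := by
      intro w hw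
      obtain rfl : w = [] := List.length_eq_zero_iff.1 (by omega)
      rw [NCSeries.sub_apply, smul_one_apply, if_pos rfl, sub_self]
    have := key 0 _ hg (fun _ => mem_tail_zero _) (fun _ => mem_tail_zero _)
    rw [map_sub, map_smul, map_one] at this
    simpa using this
  | succ r ih =>
    exact key (r + 1) f (tail_anti (by omega) hf)
      (fun i => ih _ (lder_mem_tail hf i)) (fun i => lder_mem_tail hf i)

/-- `G` fixes constants and preserves `tail k n 1`, so a constant term of `G.symm (X k i)` would
also appear in `X k i`. -/
theorem symm_X_mem_tail {G : NCSeries k n ≃ₐ[k] NCSeries k n}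
    (hG : ∀ i, G (X k i) ∈ tail k n 1) (i : Fin n) : G.symm (X k i) ∈ tail k n 1 := by
  set f := G.symm (X k i) with hf
  have hg : f - f [] • (1 : NCSeries k n) ∈ tail k n 1 := by
    intro w hw
    obtain rfl : w = [] := List.length_eq_zero_iff.1 (by omega)
    rw [NCSeries.sub_apply, smul_one_apply, if_pos rfl, sub_self]
  have h1 := map_mem_tail (G := (G : NCSeries k n →ₐ[k] NCSeries k n)) hG hg
  rw [AlgEquiv.coe_toAlgHom, map_sub, map_smul, map_one, hf, G.apply_symm_apply] at h1
  have h2 := sub_mem (X_mem_tail i) h1 [] (by simp)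
  rw [sub_sub_cancel, smul_one_apply, if_pos rfl] at h2
  have h3 : f [] = 0 := h2
  rwa [h3, zero_smul, sub_zero] at hg

/-- Formal inverse function theorem: with `A` the linear substitution inverse to the linear part of
`G`, both composites are unipotent, hence bijective. -/
theorem exists_algEquiv (b : Module.Basis (Fin n) k (Fin n → k)) (y : Fin n → NCSeries k n)
    (hy : ∀ i, y i ∈ tail k n 1) (hb : ∀ i, lin (y i) = b i) :
    ∃ G : NCSeries k n ≃ₐ[k] NCSeries k n, ∀ i, G (X k i) = y i := by
  obtain ⟨G, hG⟩ := exists_substitution y hy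
  obtain ⟨A, hA⟩ := exists_substitution (fun j => ofLin (b.equivFun (Pi.single j 1)))
    (fun _ => ofLin_mem_tail (k := k) _)
  have hG1 : ∀ i, G (X k i) ∈ tail k n 1 := fun i => by rw [hG]; exact hy i
  have hA1 : ∀ i, A (X k i) ∈ tail k n 1 := fun i => by rw [hA]; exact ofLin_mem_tail _
  have hGl : ∀ v, lin (G (ofLin v)) = b.equivFun.symm v := by
    intro v
    rw [ofLin_apply, map_sum, map_sum, b.equivFun_symm_apply]
    refine Finset.sum_congr rfl fun i _ => ?_
    rw [map_smul, map_smul, hG, hb]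
  have hAl : ∀ v, A (ofLin v) = ofLin (b.equivFun v) := by
    intro v
    have e : A.toLinearMap ∘ₗ ofLin = ofLin ∘ₗ b.equivFun.toLinearMap := by
      refine LinearMap.pi_ext' fun j => LinearMap.ext_ring ?_
      have h1 : ofLin (Pi.single j 1) = X k j := by
        rw [ofLin_apply, Finset.sum_eq_single j]
        · simp
        · intro i _ hi
          simp [hi]
        · simp
      change A (ofLin (Pi.single j 1)) = ofLin (b.equivFun (Pi.single j 1))
      rw [h1, hA]
    exact LinearMap.congr_fun e v
  have hGA := bijective_of_unipotent (G.comp A).toLinearMap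
    (sub_mem_tail_of_unipotent (K := G.comp A) fun i => mem_tail_two
      (sub_mem (map_mem_tail (G := G) hG1 (hA1 i)) (X_mem_tail i)) (by
        rw [map_sub, AlgHom.comp_apply, hA, hGl, LinearEquiv.symm_apply_apply, lin_X, sub_self]))
  have hAG := bijective_of_unipotent (A.comp G).toLinearMap
    (sub_mem_tail_of_unipotent (K := A.comp G) fun i => mem_tail_two
      (sub_mem (map_mem_tail (G := A) hA1 (hG1 i)) (X_mem_tail i)) (by
        have h1 := lin_eq_zero (map_mem_tail hA1 (sub_ofLin_mem_tail (hy i)))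
        rw [map_sub, map_sub, hAl, lin_ofLin, sub_eq_zero] at h1
        rw [map_sub, AlgHom.comp_apply, hG, h1, hb, lin_X, sub_eq_zero]
        ext j
        rw [b.equivFun_self, Pi.single_apply]
        simp only [eq_comm]))
  have hbij : Function.Bijective G :=
    ⟨Function.Injective.of_comp (f := A) hAG.1, Function.Surjective.of_comp (g := A) hGA.2⟩
  exact ⟨AlgEquiv.ofBijective G hbij, hG⟩

theorem map_closedCommutators_of_map_tail {G : NCSeries k n →ₐ[k] NCSeries k n}
    (hG : ∀ i, G (X k i) ∈ tail k n 1) {f : NCSeries k n} (hf : f ∈ closedCommutators k n) :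
    G f ∈ closedCommutators k n := by
  refine mem_adicClosure.2 fun r => ?_
  obtain ⟨c, hc, t, ht, rfl⟩ := Submodule.mem_sup.1 (mem_adicClosure.1 hf r)
  rw [map_add]
  refine add_mem (Submodule.mem_sup_left ?_) (Submodule.mem_sup_right (map_mem_tail hG ht))
  have hle : commutators k (NCSeries k n) ≤
      (commutators k (NCSeries k n)).comap G.toLinearMap := by
    rw [commutators, Submodule.span_le]
    rintro _ ⟨a, b, rfl⟩
    exact Submodule.subset_span ⟨G a, G b, by simp⟩
  exact hle hc

theorem mem_autGroup {G : NCSeries k n ≃ₐ[k] NCSeries k n} (hG : ∀ i, G (X k i) ∈ tail k n 1) :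
    G ∈ autGroup k n := by
  change (maxIdeal k n).map G.toAlgHom.toLinearMap = maxIdeal k n
  rw [maxIdeal_eq]
  apply le_antisymm
  · rintro _ ⟨f, hf, rfl⟩
    exact map_mem_tail (G := (G : NCSeries k n →ₐ[k] NCSeries k n)) hG hf
  · intro f hf
    exact ⟨G.symm f, map_mem_tail (G := (G.symm : NCSeries k n →ₐ[k] NCSeries k n))
      (symm_X_mem_tail hG) hf, G.apply_symm_apply f⟩

theorem autGroup_X_mem_tail (G : autGroup k n) (i : Fin n) : G.1 (X k i) ∈ tail k n 1 := by
  have h : (maxIdeal k n).map G.1.toAlgHom.toLinearMap = maxIdeal k n := G.2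
  rw [maxIdeal_eq] at h
  rw [← h]
  exact ⟨X k i, X_mem_tail i, rfl⟩

/-- The conjugate `G⁻¹ ξ G` of a linear map. -/
def conj (G : NCSeries k n ≃ₐ[k] NCSeries k n) (ξ : Module.End k (NCSeries k n)) :
    Module.End k (NCSeries k n) :=
  G.symm.toLinearMap ∘ₗ ξ ∘ₗ G.toLinearMap

theorem conj_apply (G : NCSeries k n ≃ₐ[k] NCSeries k n) (ξ : Module.End k (NCSeries k n))
    (f : NCSeries k n) : conj G ξ f = G.symm (ξ (G f)) := rfl

theorem isDer_conj (G : NCSeries k n ≃ₐ[k] NCSeries k n) {ξ : Module.End k (NCSeries k n)}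
    (hξ : IsDer ξ) : IsDer (conj G ξ) := by
  intro f g
  simp only [conj_apply]
  rw [map_mul, hξ, map_add, map_mul, map_mul, G.symm_apply_apply, G.symm_apply_apply]

theorem conj_mem_tail {G : NCSeries k n ≃ₐ[k] NCSeries k n} (hG : ∀ i, G (X k i) ∈ tail k n 1)
    {ξ : Module.End k (NCSeries k n)} (hξ : ∀ r, ∀ f ∈ tail k n r, ξ f ∈ tail k n r) (r : ℕ)
    (f : NCSeries k n) (hf : f ∈ tail k n r) : conj G ξ f ∈ tail k n r :=
  map_mem_tail (G := (G.symm : NCSeries k n →ₐ[k] NCSeries k n)) (symm_X_mem_tail hG)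
    (hξ r _ (map_mem_tail (G := (G : NCSeries k n →ₐ[k] NCSeries k n)) hG hf))

theorem conj_sub_mem {G : NCSeries k n ≃ₐ[k] NCSeries k n} (hG : ∀ i, G (X k i) ∈ tail k n 1)
    {ξ : Module.End k (NCSeries k n)} {f g : NCSeries k n}
    (h : ξ (G f) - g ∈ closedCommutators k n) :
    conj G ξ f - G.symm g ∈ closedCommutators k n := by
  have := map_closedCommutators_of_map_tail (G := (G.symm : NCSeries k n →ₐ[k] NCSeries k n))
    (symm_X_mem_tail hG) h
  rwa [AlgEquiv.coe_toAlgHom, map_sub] at this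

theorem conj_pow_apply (G : NCSeries k n ≃ₐ[k] NCSeries k n) (ξ : Module.End k (NCSeries k n))
    (μ : k) (p : ℕ) (f : NCSeries k n) :
    ((conj G ξ - μ • 1 : Module.End k (NCSeries k n)) ^ p) f =
      G.symm (((ξ - μ • 1 : Module.End k (NCSeries k n)) ^ p) (G f)) := by
  induction p with
  | zero => exact (G.symm_apply_apply f).symm
  | succ p ih =>
    rw [pow_succ', pow_succ', Module.End.mul_apply, Module.End.mul_apply, ih,
      LinearMap.sub_apply, LinearMap.sub_apply, map_sub, conj_apply, G.apply_symm_apply]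
    congr 1
    rw [LinearMap.smul_apply, LinearMap.smul_apply, map_smul]
    rfl

/-! ### The normal form of a derivation fixing a superpotential -/

/-- A basis is extracted from the spanning set of generalized eigenvectors. An eigenvalue missing
from `l` would have its eigenspace inside the sum of the other generalized eigenspaces, against
independence. -/
theorem exists_genEigen_basis [IsAlgClosed k] (T : Module.End k (Fin n → k)) :
    ∃ (b : Module.Basis (Fin n) k (Fin n → k)) (l : Fin n → k),
      (∀ i, b i ∈ T.maxGenEigenspace (l i)) ∧ ∀ μ, T.HasEigenvalue μ → ∃ i, μ = l i := by
  have hspan : ⊤ ≤ Submodule.span k {v | ∃ μ, v ∈ T.maxGenEigenspace μ} := by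
    rw [← Module.End.iSup_maxGenEigenspace_eq_top T]
    exact iSup_le fun μ v hv => Submodule.subset_span ⟨μ, hv⟩
  let b0 := Module.Basis.ofSpan hspan
  have hfin : Finite _ := Module.Finite.finite_basis b0
  have hcard : Nat.card _ = n := (Module.finrank_eq_nat_card_basis b0).symm.trans (by simp)
  let e := Finite.equivFinOfCardEq hcard
  let b := b0.reindex e
  have hb : ∀ i, ∃ μ, b i ∈ T.maxGenEigenspace μ := by
    intro i
    have := Module.Basis.ofSpan_subset hspan ⟨e.symm i, rfl⟩
    rw [Module.Basis.reindex_apply]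
    exact this
  choose l hl using hb
  refine ⟨b, l, hl, fun μ hμ => ?_⟩
  by_contra hne
  have hle : (⊤ : Submodule k (Fin n → k)) ≤ ⨆ ν ≠ μ, T.maxGenEigenspace ν := by
    rw [← b.span_eq, Submodule.span_le]
    rintro _ ⟨i, rfl⟩
    exact Submodule.mem_iSup_of_mem (l i) (Submodule.mem_iSup_of_mem
      (fun h => hne ⟨i, h.symm⟩) (hl i))
  obtain ⟨v, hv⟩ := hμ.exists_hasEigenvector
  have hv1 : v ∈ T.maxGenEigenspace μ := by
    rw [Module.End.mem_maxGenEigenspace]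
    refine ⟨1, ?_⟩
    rw [pow_one, LinearMap.sub_apply, hv.apply_eq_smul]
    exact sub_self _
  exact hv.2 (Submodule.disjoint_def.1 (T.independent_maxGenEigenspace μ) v hv1
    (hle Submodule.mem_top))

/-- A derivation fixing a superpotential yields coordinates in which the superpotential is
homogeneous with respect to the eigenvalues of the linear part of the derivation. -/
theorem exists_normalForm [IsAlgClosed k] {φ : NCSeries k n} {ξ : Module.End k (NCSeries k n)}
    (hd : IsDer ξ) (hX : ∀ i, ξ (X k i) ∈ tail k n 1) (hφ : ξ φ - φ ∈ closedCommutators k n) :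
    ∃ (G : NCSeries k n ≃ₐ[k] NCSeries k n) (l : Fin n → k),
      (∀ i, G (X k i) ∈ tail k n 1) ∧
      G.symm φ - weightPart l (G.symm φ) ∈ closedCommutators k n ∧
      ∀ μ, (linPart ξ).HasEigenvalue μ → ∃ i, μ = l i := by
  have hξ : ∀ r, ∀ f ∈ tail k n r, ξ f ∈ tail k n r := fun r f hf => hd.map_tail hX hf
  obtain ⟨b, l, hbl, hl⟩ := exists_genEigen_basis (linPart ξ)
  -- Each basis vector `b i` of the space of linear forms lifts to a topological generalized
  -- eigenvector with linear part `b i`.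
  have hy : ∀ i, ∃ z, IsGenEigen ξ (l i) z ∧ z - ofLin (b i) ∈ tail k n 2 := by
    intro i
    refine exists_isGenEigen hξ (l i) 2 _ ?_
    obtain ⟨p, hp⟩ := (Module.End.mem_maxGenEigenspace _ _ _).1 (hbl i)
    refine ⟨p, mem_tail_two (pow_apply_mem_tail hξ _ p (ofLin_mem_tail _)) ?_⟩
    rw [← linPart_pow_lin hξ _ p (ofLin_mem_tail _), lin_ofLin, hp]
  choose y hyg hyb using hy
  have hy1 : ∀ i, y i ∈ tail k n 1 := fun i => by
    have := add_mem (tail_anti (by omega) (hyb i)) (ofLin_mem_tail (b i))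
    rwa [sub_add_cancel] at this
  have hyl : ∀ i, lin (y i) = b i := fun i => by
    have := lin_eq_zero (hyb i)
    rwa [map_sub, lin_ofLin, sub_eq_zero] at this
  obtain ⟨G, hG⟩ := exists_algEquiv b y hy1 hyl
  have hG1 : ∀ i, G (X k i) ∈ tail k n 1 := fun i => by rw [hG]; exact hy1 i
  refine ⟨G, l, hG1, ?_, hl⟩
  -- In the coordinates `y i = G(x_i)` the derivation becomes `conj G ξ`, for which the variables
  -- themselves are generalized eigenvectors.
  refine sub_weightPart_mem (ξ := conj G ξ) (isDer_conj G hd) (conj_mem_tail hG1 hξ)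
    (fun i r => ?_) ?_
  · obtain ⟨p, hp⟩ := hyg i r
    refine ⟨p, ?_⟩
    rw [conj_pow_apply, hG]
    exact map_mem_tail (G := (G.symm : NCSeries k n →ₐ[k] NCSeries k n))
      (symm_X_mem_tail hG1) hp
  · refine conj_sub_mem hG1 ?_
    rwa [G.apply_symm_apply]

end LinearParts

/-! ### Systems of weights -/

/-- A nonpositive weight forces a weight at least `1`. From a maximal weight `r m ≥ 1` the equations
then give `r j ≤ 1 - 2 * r m < 0` and next `r l ≥ 4 * r m - 1 > r m`, a contradiction. Once all
weights are positive, `2 * r i ≤ 1 - r j < 1`. -/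
theorem weights_pos_lt_half {n : ℕ} {r : Fin n → ℚ}
    (h : ∀ i, ∃ (j : Fin n) (a : ℕ), 2 ≤ a ∧ a * r i + r j = 1) (i : Fin n) :
    0 < r i ∧ r i < 1 / 2 := by
  have hpos : ∀ i, 0 < r i := by
    by_contra! hneg
    obtain ⟨i0, hi0⟩ := hneg
    obtain ⟨m, -, hm⟩ := Finset.exists_max_image Finset.univ r ⟨i0, Finset.mem_univ i0⟩
    replace hm : ∀ i, r i ≤ r m := fun i => hm i (Finset.mem_univ i)
    obtain ⟨j0, a0, ha0, e0⟩ := h i0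
    have h1 : 1 ≤ r m := by
      have : (a0 : ℚ) * r i0 ≤ 0 := mul_nonpos_of_nonneg_of_nonpos (by positivity) hi0
      linarith [hm j0]
    obtain ⟨j, a, ha, e⟩ := h m
    obtain ⟨l, b, hb, e'⟩ := h j
    have ha' : (2 : ℚ) ≤ a := by exact_mod_cast ha
    have hb' : (2 : ℚ) ≤ b := by exact_mod_cast hb
    have h2 : r j ≤ 1 - 2 * r m := by nlinarith
    have h3 : 1 - 2 * r j ≤ r l := by nlinarith
    linarith [hm l]
  refine ⟨hpos i, ?_⟩
  obtain ⟨j, a, ha, e⟩ := h i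
  have ha' : (2 : ℚ) ≤ a := by exact_mod_cast ha
  nlinarith [hpos i, hpos j]

/-- Under any `ℚ`-linear functional on `k`, an entry of maximal absolute value would be followed by
one at least twice as large. The functionals separate points. -/
theorem eq_zero_of_expanding {k : Type u} [Field k] [CharZero k] {n : ℕ} {d : Fin n → k}
    (h : ∀ i, ∃ (j : Fin n) (a : ℕ), 2 ≤ a ∧ a * d i + d j = 0) : d = 0 := by
  funext i
  refine (Module.forall_dual_apply_eq_zero_iff ℚ (d i)).1 fun ρ => ?_
  obtain ⟨m, -, hm⟩ := Finset.exists_max_image Finset.univ (fun i => |ρ (d i)|)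
    ⟨i, Finset.mem_univ i⟩
  obtain ⟨j, a, ha, e⟩ := h m
  have ha' : (2 : ℚ) ≤ a := by exact_mod_cast ha
  have e' : (a : ℚ) * ρ (d m) + ρ (d j) = 0 := by
    have := congrArg ρ e
    rwa [map_add, map_zero, ← nsmul_eq_mul, map_nsmul, nsmul_eq_mul] at this
  have h1 : |ρ (d j)| = a * |ρ (d m)| := by
    rw [show ρ (d j) = -(a * ρ (d m)) by linarith, abs_neg, abs_mul, Nat.abs_cast]
  have h2 := hm j (Finset.mem_univ j)
  have h3 := hm i (Finset.mem_univ i)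
  simp only [h1] at h2 h3
  have h4 : |ρ (d m)| ≤ 0 := by nlinarith [abs_nonneg (ρ (d m))]
  exact abs_nonpos_iff.1 (h3.trans h4)

/-- The choices of `(j, a)` for each `i` are finite in number, and two solutions for the same choice
differ by a solution of the homogeneous system. -/
theorem finite_weights (k : Type u) [Field k] [CharZero k] (n N : ℕ) :
    {l : Fin n → k | ∀ i, ∃ (j : Fin n) (a : ℕ), 2 ≤ a ∧ a ≤ N ∧ a * l i + l j = 1}.Finite := by
  refine Set.Finite.subset (Set.finite_iUnion fun c : Fin n → Fin n × Fin (N + 1) =>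
    Set.Subsingleton.finite (s := {l : Fin n → k | ∀ i, 2 ≤ ((c i).2 : ℕ) ∧
      ((c i).2 : ℕ) * l i + l (c i).1 = 1}) ?_) ?_
  · intro l hl l' hl'
    rw [← sub_eq_zero]
    refine eq_zero_of_expanding fun i => ⟨(c i).1, (c i).2, (hl i).1, ?_⟩
    rw [Pi.sub_apply, Pi.sub_apply]
    linear_combination (hl i).2 - (hl' i).2
  · intro l hl
    choose j a h1 h2 h3 using hl
    exact Set.mem_iUnion.2 ⟨fun i => (j i, ⟨a i, by have := h2 i; omega⟩),
      fun i => ⟨h1 i, h3 i⟩⟩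

/-! ### Characteristic polynomials in a pencil -/

/-- Only finitely many monic polynomials of degree `n` have all roots in `E`, so one of them is the
characteristic polynomial for infinitely many `t`. As the coefficients depend polynomially on `t`,
it is so for all `t`; the conclusion compares `t = 0` and `t = 1`. -/
theorem charpoly_eq_add_of_finite {k : Type u} [Field k] [IsAlgClosed k] {n : ℕ} {E : Set k}
    (hE : E.Finite) (A B : Matrix (Fin n) (Fin n) k)
    (h : ∀ t : k, ∀ μ ∈ (A + t • B).charpoly.roots, μ ∈ E) :
    A.charpoly = (A + B).charpoly := by
  have : Finite E := hE
  have hinf : Infinite k := IsAlgClosed.instInfinite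
  have hex : ∀ t : k, ∃ v : Fin n → E,
      (A + t • B).charpoly = ∏ i, (Polynomial.X - Polynomial.C (v i : k)) := by
    intro t
    set p := (A + t • B).charpoly
    have hp : p.Splits := IsAlgClosed.splits p
    have hcard : p.roots.toList.length = n := by
      rw [Multiset.length_toList, ← hp.natDegree_eq_card_roots, Matrix.charpoly_natDegree_eq_dim,
        Fintype.card_fin]
    refine ⟨fun i => ⟨p.roots.toList.get (i.cast hcard.symm),
      h t _ (Multiset.mem_toList.1 (List.get_mem _ _))⟩, ?_⟩
    have h1 := hp.eq_prod_roots_of_monic (Matrix.charpoly_monic _)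
    have h2 : (p.roots.map fun a => Polynomial.X - Polynomial.C a).prod =
        ∏ i, (Polynomial.X - Polynomial.C (p.roots.toList.get (Fin.cast hcard.symm i))) := by
      conv_lhs => rw [← Multiset.coe_toList p.roots]
      rw [Multiset.map_coe, Multiset.prod_coe]
      nth_rewrite 1 [← List.ofFn_get p.roots.toList]
      rw [List.map_ofFn, List.prod_ofFn]
      exact Fintype.prod_equiv (finCongr hcard) _ _ fun i => by simp
    exact h1.trans h2
  choose v hv using hex
  obtain ⟨v0, hv0⟩ := Finite.exists_infinite_fiber v
  refine Polynomial.funext fun c => ?_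
  -- The polynomial variable of `M` is the pencil parameter `t`; the argument `c` of the
  -- characteristic polynomial is fixed.
  let M : Matrix (Fin n) (Fin n) (Polynomial k) :=
    (Matrix.scalar (Fin n) c - A).map (Polynomial.C : k →+* Polynomial k) -
      (Polynomial.X : Polynomial k) • B.map (Polynomial.C : k →+* Polynomial k)
  have hM : ∀ t, M.det.eval t = (A + t • B).charpoly.eval c := by
    intro t
    rw [Matrix.eval_charpoly, ← Polynomial.coe_evalRingHom, RingHom.map_det]
    congr 1
    ext i j
    simp [M, sub_sub, mul_comm t]
  have hconst : M.det = Polynomial.C ((∏ i, (Polynomial.X - Polynomial.C (v0 i : k))).eval c) := by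
    refine Polynomial.eq_of_infinite_eval_eq _ _ (Set.Infinite.mono ?_
      (Set.infinite_coe_iff.1 hv0))
    intro t ht
    have ht' : v t = v0 := ht
    rw [Set.mem_ofPred_eq, hM, hv, ht', Polynomial.eval_C]
  have h0 := hM 0
  have h1 := hM 1
  rw [hconst, Polynomial.eval_C] at h0 h1
  rw [zero_smul, add_zero] at h0
  rw [one_smul] at h1
  rw [← h0, h1]

/-- The root multisets coincide over `ℚ`, so `r` and `s` have equinumerous fibres; gluing bijections
of the fibres gives `σ`. -/
theorem exists_perm_of_prod_eq {k : Type u} [Field k] [CharZero k] {n : ℕ} {r s : Fin n → ℚ}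
    (h : ∏ i, (Polynomial.X - Polynomial.C (r i : k)) =
      ∏ i, (Polynomial.X - Polynomial.C (s i : k))) :
    ∃ σ : Equiv.Perm (Fin n), ∀ i, s i = r (σ i) := by
  have hroots : ∀ t : Fin n → ℚ, (∏ i, (Polynomial.X - Polynomial.C (t i : k))).roots =
      (Finset.univ.val.map t).map (fun q : ℚ => (q : k)) := by
    intro t
    have := Polynomial.roots_multiset_prod_X_sub_C
      ((Finset.univ.val.map t).map (fun q : ℚ => (q : k)))
    rw [← this, Multiset.map_map, Multiset.map_map]
    rfl
  have h1 := congrArg Polynomial.roots h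
  rw [hroots, hroots] at h1
  have h2 := Multiset.map_injective Rat.cast_injective h1
  have hcard : ∀ q, Nonempty ({i // s i = q} ≃ {i // r i = q}) := by
    intro q
    have h3 := congrArg (Multiset.count q) h2
    rw [Multiset.count_map, Multiset.count_map] at h3
    refine Fintype.card_eq.1 ?_
    rw [Fintype.card_subtype, Fintype.card_subtype]
    simp only [eq_comm (b := q)]
    exact h3.symm
  have e' := fun q => Classical.choice (hcard q)
  refine ⟨(Equiv.sigmaFiberEquiv s).symm.trans
    ((Equiv.sigmaCongrRight e').trans (Equiv.sigmaFiberEquiv r)), fun i => ?_⟩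
  exact (e' (s i) ⟨i, rfl⟩).2.symm

/-! ### Words that must occur, the Euler derivation, and existence and uniqueness of weights. -/

section Main

variable {k : Type u} [Field k] {n : ℕ}

open NCSeries

/-! ### Words forced by finite dimensionality -/

/-- The coefficient of `D_j ψ` at `x_i ^ a` is a sum of coefficients of `ψ` at words `x_i^p x_j
x_i^q` with `p + q = a`. If these all vanished, `jac ψ` would lie in the closed ideal `U` of series
without the powers `x_i ^ a`, `a ≤ N`, yet it contains `x_i ^ N`. -/
theorem exists_word_of_tail_le_jac {ψ : NCSeries k n} {N : ℕ} (hN : tail k n N ≤ jac ψ)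
    (hψ : ∀ j, cyclicDer j ψ ∈ tail k n 2) (i : Fin n) :
    ∃ (j : Fin n) (p q : ℕ), 2 ≤ p + q ∧ p + q ≤ N ∧
      ψ (List.replicate p i ++ j :: List.replicate q i) ≠ 0 := by
  by_contra! hne
  let U : Submodule k (NCSeries k n) :=
    { carrier := {f | ∀ a ≤ N, f (List.replicate a i) = 0}
      add_mem' := fun hf hg a ha => by rw [NCSeries.add_apply, hf a ha, hg a ha, add_zero]
      zero_mem' := fun _ _ => rfl
      smul_mem' := fun c f hf a ha => by rw [NCSeries.smul_apply, hf a ha, mul_zero] }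
  have hU : IsAdicClosed U := by
    intro f hf a ha
    obtain ⟨u, hu, t, ht, rfl⟩ := Submodule.mem_sup.1 (hf (N + 1))
    rw [NCSeries.add_apply, hu a ha, ht _ (by rw [List.length_replicate]; omega), add_zero]
  have hrep : ∀ {a : ℕ} {p q : List (Fin n)}, p ++ q = List.replicate a i →
      p = List.replicate p.length i ∧ q = List.replicate q.length i ∧
        p.length + q.length = a := by
    intro a p q h
    obtain ⟨h1, h2, h3⟩ := List.append_eq_replicate_iff.1 h
    exact ⟨h2, h3, h1⟩
  have hl : ∀ g, ∀ f ∈ U, g * f ∈ U := by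
    intro g f hf a ha
    rw [mul_apply, ← splitSum_zero (List.replicate a i)]
    refine splitSum_congr fun p q h => ?_
    obtain ⟨-, h2, h3⟩ := hrep h
    rw [h2, hf _ (by omega), mul_zero]
  have hr : ∀ f ∈ U, ∀ g, f * g ∈ U := by
    intro f hf g a ha
    rw [mul_apply, ← splitSum_zero (List.replicate a i)]
    refine splitSum_congr fun p q h => ?_
    obtain ⟨h2, -, h3⟩ := hrep h
    rw [h2, hf _ (by omega), zero_mul]
  have hD : ∀ j, cyclicDer j ψ ∈ U := by
    intro j a ha
    -- The exponents `0` and `1` are excluded by the order of `D_j ψ`; this is where order at least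
    -- three yields `2 ≤ p + q`.
    by_cases h2 : a < 2
    · exact hψ j _ (by rwa [List.length_replicate])
    · rw [cyclicDer_apply, ← splitSum_zero (List.replicate a i)]
      refine splitSum_congr fun v w h => ?_
      obtain ⟨e1, e2, e3⟩ := hrep h
      rw [e1, e2]
      exact hne j _ _ (by omega) (by omega)
  have h1 := jac_le hU hl hr hD
    (hN (by simpa using word_mem_tail (k := k) (List.replicate N i))) N le_rfl
  simp [word] at h1

theorem sum_map_replicate {M : Type*} [Semiring M] (l : Fin n → M) (i j : Fin n) (p q : ℕ) :
    ((List.replicate p i ++ j :: List.replicate q i).map l).sum =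
      ((p + q : ℕ) : M) * l i + l j := by
  simp only [List.map_append, List.map_cons, List.map_replicate, List.sum_append, List.sum_cons,
    List.sum_replicate, nsmul_eq_mul, Nat.cast_add, add_mul]
  abel

/-! ### The Euler derivation -/

variable (k) in
/-- The derivation multiplying each word by its weight. -/
def euler (r : Fin n → ℚ) : Module.End k (NCSeries k n) where
  toFun f w := ((w.map r).sum : k) * f w
  map_add' f g := by
    ext w
    exact mul_add _ (f w) (g w)
  map_smul' c f := by
    ext w
    exact mul_left_comm _ c (f w)

theorem euler_apply (r : Fin n → ℚ) (f : NCSeries k n) (w : List (Fin n)) :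
    euler k r f w = ((w.map r).sum : k) * f w := rfl

theorem isDer_euler [CharZero k] (r : Fin n → ℚ) : IsDer (euler k r) := by
  intro f g
  ext w
  rw [NCSeries.add_apply, euler_apply, mul_apply, mul_apply, mul_apply, ← splitSum_mul_left,
    ← splitSum_add]
  refine splitSum_congr fun p q h => ?_
  rw [← h, List.map_append, List.sum_append, euler_apply, euler_apply]
  push_cast
  ring

theorem euler_mem_tail (r : Fin n → ℚ) (s : ℕ) (f : NCSeries k n) (hf : f ∈ tail k n s) :
    euler k r f ∈ tail k n s := fun w hw => by rw [euler_apply, hf w hw, mul_zero]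

theorem linPart_euler (r : Fin n → ℚ) :
    linPart (euler k r) = Matrix.toLin' (Matrix.diagonal fun i => (r i : k)) := by
  refine LinearMap.ext fun v => funext fun i => ?_
  have h : ofLin v [i] = v i := congrFun (lin_ofLin v) i
  rw [linPart_apply, lin_apply, euler_apply, h, Matrix.toLin'_apply, Matrix.mulVec_diagonal]
  simp

theorem charpoly_linPart_euler (r : Fin n → ℚ) :
    (linPart (euler k r)).charpoly = ∏ i, (Polynomial.X - Polynomial.C (r i : k)) := by
  rw [linPart_euler, ← LinearMap.charpoly_toMatrix _ (Pi.basisFun k (Fin n)),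
    LinearMap.toMatrix_eq_toMatrix', LinearMap.toMatrix'_toLin', Matrix.charpoly_diagonal]

/-- Taking linear parts is compatible with composition of filtration-preserving maps, so conjugation
by `G` becomes conjugation by its linear part. -/
theorem charpoly_linPart_conj {G : NCSeries k n ≃ₐ[k] NCSeries k n}
    (hG : ∀ i, G (X k i) ∈ tail k n 1) {ξ : Module.End k (NCSeries k n)}
    (hξ : ∀ r, ∀ f ∈ tail k n r, ξ f ∈ tail k n r) :
    (linPart (conj G ξ)).charpoly = (linPart ξ).charpoly := by
  have hGt : ∀ r, ∀ f ∈ tail k n r, G.toLinearMap f ∈ tail k n r := fun r f hf =>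
    map_mem_tail (G := (G : NCSeries k n →ₐ[k] NCSeries k n)) hG hf
  have hGt' : ∀ r, ∀ f ∈ tail k n r, G.symm.toLinearMap f ∈ tail k n r := fun r f hf =>
    map_mem_tail (G := (G.symm : NCSeries k n →ₐ[k] NCSeries k n)) (symm_X_mem_tail hG) hf
  let e : (Fin n → k) ≃ₗ[k] (Fin n → k) := LinearEquiv.ofLinearMap (linPart G.symm.toLinearMap)
    (linPart G.toLinearMap)
    (LinearMap.ext fun v => by
      rw [LinearMap.comp_apply, linPart_apply G.toLinearMap,
        linPart_lin hGt' (hGt _ _ (ofLin_mem_tail v))]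
      simp [lin_ofLin])
    (LinearMap.ext fun v => by
      rw [LinearMap.comp_apply, linPart_apply G.symm.toLinearMap,
        linPart_lin hGt (hGt' _ _ (ofLin_mem_tail v))]
      simp [lin_ofLin])
  rw [← e.charpoly_conj (linPart ξ)]
  congr 1
  refine LinearMap.ext fun v => ?_
  rw [LinearEquiv.conj_apply_apply]
  change _ = linPart G.symm.toLinearMap (linPart ξ (linPart G.toLinearMap v))
  rw [linPart_apply G.toLinearMap, linPart_lin hξ (hGt _ _ (ofLin_mem_tail v)),
    linPart_lin hGt' (hξ _ _ (hGt _ _ (ofLin_mem_tail v)))]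
  rfl

/-- The Euler derivation fixes the weighted-homogeneous representative; its conjugate by the right
equivalence fixes `φ`. -/
theorem exists_isDer_of_isWeightedHomogeneous [CharZero k] {r : Fin n → ℚ} {φ : NCSeries k n}
    (h : ∃ Ψ : Superpotential k n, RightEquivalent (proj φ) Ψ ∧ IsWeightedHomogeneous r Ψ) :
    ∃ ξ : Module.End k (NCSeries k n), IsDer ξ ∧ (∀ i, ξ (X k i) ∈ tail k n 1) ∧
      ξ φ - φ ∈ closedCommutators k n ∧
      (linPart ξ).charpoly = ∏ i, (Polynomial.X - Polynomial.C (r i : k)) := by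
  obtain ⟨Ψ, ⟨H, hH⟩, -, ψ, hψ, hw⟩ := h
  have hHX := autGroup_X_mem_tail H
  have hE : euler k r ψ = ψ := by
    ext w
    rw [euler_apply]
    by_cases h0 : ψ w = 0
    · rw [h0, mul_zero]
    · rw [hw w h0, Rat.cast_one, one_mul]
  have hd : H.1 φ - ψ ∈ closedCommutators k n := by
    refine (Submodule.Quotient.eq _).1 ?_
    exact hH.trans hψ.symm
  refine ⟨conj H.1 (euler k r), isDer_conj _ (isDer_euler r), fun i =>
    conj_mem_tail hHX (euler_mem_tail r) 1 _ (X_mem_tail i), ?_, ?_⟩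
  · have := conj_sub_mem (ξ := euler k r) (f := φ) (g := H.1 φ) hHX (by
      have := sub_mem ((isDer_euler r).map_closedCommutators hd) hd
      rw [map_sub, hE] at this
      simpa using this)
    rwa [H.1.symm_apply_apply] at this
  · rw [charpoly_linPart_conj hHX (euler_mem_tail r), charpoly_linPart_euler]

/-! ### Existence and uniqueness of weights -/

/-- Homogeneous coordinates for a derivation fixing a superpotential of order at least three with
finite dimensional Jacobi algebra. -/
theorem exists_homogeneous [IsAlgClosed k] {φ : NCSeries k n} (hφ : φ ∈ tail k n 3) {N : ℕ}
    (hN : tail k n N ≤ jac φ) {ξ : Module.End k (NCSeries k n)} (hd : IsDer ξ)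
    (hX : ∀ i, ξ (X k i) ∈ tail k n 1) (h : ξ φ - φ ∈ closedCommutators k n) :
    ∃ (H : autGroup k n) (l : Fin n → k) (ψ : NCSeries k n),
      autAct H (proj φ) = proj ψ ∧ (∀ w, ψ w ≠ 0 → (w.map l).sum = 1) ∧
      (∀ μ, (linPart ξ).HasEigenvalue μ → ∃ i, μ = l i) ∧
      ∀ i, ∃ (j : Fin n) (p q : ℕ), 2 ≤ p + q ∧ p + q ≤ N ∧
        ψ (List.replicate p i ++ j :: List.replicate q i) ≠ 0 := by
  obtain ⟨G, l, hG, hψ, hl⟩ := exists_normalForm hd hX h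
  have hG' := symm_X_mem_tail hG
  set ψ := weightPart l (G.symm φ) with hψdef
  refine ⟨⟨G.symm, mem_autGroup hG'⟩, l, ψ, ?_, ?_, hl, ?_⟩
  · exact (Submodule.Quotient.eq _).2 hψ
  · intro w hw
    by_contra hne
    exact hw (weightPart_apply_of_ne hne _)
  · have h1 : G ψ - φ ∈ closedCommutators k n := by
      have := neg_mem (map_closedCommutators_of_map_tail
        (G := (G : NCSeries k n →ₐ[k] NCSeries k n)) hG hψ)
      rwa [AlgEquiv.coe_toAlgHom, map_sub, G.apply_symm_apply, neg_sub] at this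
    refine exists_word_of_tail_le_jac (tail_le_jac_of_map G hG hG' h1 hN) fun j => ?_
    have h2 := cyclicDer_eq_zero hψ j
    rw [map_sub, sub_eq_zero] at h2
    rw [← h2]
    exact cyclicDer_mem_tail
      (map_mem_tail (G := (G.symm : NCSeries k n →ₐ[k] NCSeries k n)) hG' hφ) j

theorem exists_isWeightedHomogeneous [CharZero k] [IsAlgClosed k] {φ : NCSeries k n} (hφ : φ ∈ tail k n 3)
    {N : ℕ} (hN : tail k n N ≤ jac φ) (hq : IsQuasiHomogeneous (proj φ)) :
    ∃ r : Fin n → ℚ, (∀ i, 0 < r i ∧ r i < 1 / 2) ∧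
      ∃ Ψ : Superpotential k n, RightEquivalent (proj φ) Ψ ∧ IsWeightedHomogeneous r Ψ := by
  obtain ⟨ξ, hd, hξ⟩ := exists_isDer_of_isQuasiHomogeneous hN hq
  have hX := isDer_X_mem_tail (tail_anti (by omega) hφ) hN hd hξ
  obtain ⟨H, l, ψ, hH, hw, -, hi⟩ := exists_homogeneous hφ hN hd hX hξ
  -- A `ℚ`-linear retraction `ρ : k → ℚ` keeps every relation that gives a word weight `1`, so the
  -- `l i` need not be known to be rational.
  obtain ⟨ρ, hρ⟩ := LinearMap.exists_leftInverse_of_injective (Algebra.linearMap ℚ k)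
    (LinearMap.ker_eq_bot.2 (algebraMap ℚ k).injective)
  have hρ1 : ρ 1 = 1 := by
    have := LinearMap.congr_fun hρ 1
    simpa using this
  have hw' : ∀ w, ψ w ≠ 0 → (w.map fun i => ρ (l i)).sum = 1 := by
    intro w h0
    rw [← hρ1, ← hw w h0, map_list_sum, List.map_map]
    rfl
  have hr := weights_pos_lt_half (r := fun i => ρ (l i)) fun i => by
    obtain ⟨j, p, q, h2, -, h0⟩ := hi i
    refine ⟨j, p + q, h2, ?_⟩
    have := hw' _ h0
    rwa [sum_map_replicate] at this
  exact ⟨fun i => ρ (l i), hr, proj ψ, ⟨H, hH⟩, fun i => ⟨(hr i).1, (hr i).2.le⟩, ψ, rfl, hw'⟩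

/-- Every derivation on the line through `ξ` and `η` fixes `φ`, so its eigenvalues lie among the
entries of the finitely many weight systems bounded by `N`. This bound does not depend on `t`, and
the pencil lemma applies. -/
theorem charpoly_linPart_eq [CharZero k] [IsAlgClosed k] {φ : NCSeries k n} (hφ : φ ∈ tail k n 3) {N : ℕ}
    (hN : tail k n N ≤ jac φ) {ξ η : Module.End k (NCSeries k n)} (hξ : IsDer ξ) (hη : IsDer η)
    (hξX : ∀ i, ξ (X k i) ∈ tail k n 1) (hηX : ∀ i, η (X k i) ∈ tail k n 1)
    (hξφ : ξ φ - φ ∈ closedCommutators k n) (hηφ : η φ - φ ∈ closedCommutators k n) :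
    (linPart ξ).charpoly = (linPart η).charpoly := by
  set S := {l : Fin n → k |
    ∀ i, ∃ (j : Fin n) (a : ℕ), 2 ≤ a ∧ a ≤ N ∧ a * l i + l j = 1}
  have hE : (⋃ l ∈ S, Set.range l).Finite :=
    (finite_weights k n N).biUnion fun l _ => Set.finite_range l
  have hpencil : ∀ t μ : k, (linPart (ξ + t • (η - ξ))).HasEigenvalue μ →
      μ ∈ ⋃ l ∈ S, Set.range l := by
    intro t μ hμ
    have hd : IsDer (ξ + t • (η - ξ)) := by
      intro f g
      simp only [LinearMap.add_apply, LinearMap.smul_apply, LinearMap.sub_apply]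
      rw [hξ, hη, add_mul, mul_add, smul_mul_assoc, mul_smul_comm, sub_mul, mul_sub,
        ← sub_eq_zero]
      simp only [smul_sub, smul_add]
      abel
    have hX : ∀ i, (ξ + t • (η - ξ)) (X k i) ∈ tail k n 1 := fun i =>
      add_mem (hξX i) (Submodule.smul_mem _ t (sub_mem (hηX i) (hξX i)))
    have h : (ξ + t • (η - ξ)) φ - φ ∈ closedCommutators k n := by
      have := add_mem hξφ (Submodule.smul_mem _ t (sub_mem hηφ hξφ))
      convert this using 1
      simp only [LinearMap.add_apply, LinearMap.smul_apply, LinearMap.sub_apply, smul_sub]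
      abel
    obtain ⟨-, l, ψ, -, hw, hl, hi⟩ := exists_homogeneous hφ hN hd hX h
    obtain ⟨i, rfl⟩ := hl μ hμ
    refine Set.mem_biUnion (fun i => ?_) ⟨i, rfl⟩
    obtain ⟨j, p, q, h2, h3, h0⟩ := hi i
    refine ⟨j, p + q, h2, h3, ?_⟩
    have := hw _ h0
    rwa [sum_map_replicate] at this
  have hc : ∀ T : Module.End k (Fin n → k), T.charpoly = (LinearMap.toMatrix' T).charpoly :=
    fun T => by rw [← LinearMap.charpoly_toMatrix T (Pi.basisFun k (Fin n)),
      LinearMap.toMatrix_eq_toMatrix']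
  have key := charpoly_eq_add_of_finite hE (LinearMap.toMatrix' (linPart ξ))
    (LinearMap.toMatrix' (linPart (η - ξ))) fun t μ hμ => hpencil t μ (by
      rw [Module.End.hasEigenvalue_iff_isRoot_charpoly, hc, map_add, map_smul, map_add, map_smul]
      exact Polynomial.isRoot_of_mem_roots hμ)
  rw [hc, hc, key, ← map_add, ← map_add, add_sub_cancel]

end Main

end NCSaito

end

theorem theorem4p1 {k : Type*} [Field k] [IsAlgClosed k] [CharZero k] (n : ℕ) (hn : 1 ≤ n)
    (Φ : NCSaito.Superpotential k n) (hord : 3 ≤ NCSaito.order Φ)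
    (hfin : FiniteDimensional k (NCSaito.JacobiAlgebra Φ)) :
    (NCSaito.IsQuasiHomogeneous Φ ↔
      ∃ r : Fin n → ℚ, (∀ i, 0 < r i ∧ r i < 1 / 2) ∧
        ∃ Ψ : NCSaito.Superpotential k n,
          NCSaito.RightEquivalent Φ Ψ ∧ NCSaito.IsWeightedHomogeneous r Ψ) ∧
    (∀ r s : Fin n → ℚ, (∀ i, 0 < r i ∧ r i < 1 / 2) → (∀ i, 0 < s i ∧ s i < 1 / 2) →
      (∃ Ψ : NCSaito.Superpotential k n,
        NCSaito.RightEquivalent Φ Ψ ∧ NCSaito.IsWeightedHomogeneous r Ψ) →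
      (∃ Ψ : NCSaito.Superpotential k n,
        NCSaito.RightEquivalent Φ Ψ ∧ NCSaito.IsWeightedHomogeneous s Ψ) →
      ∃ σ : Equiv.Perm (Fin n), ∀ i, s i = r (σ i)) := by
  -- Replace the superpotential by a representative of order at least three.
  obtain ⟨φ, hφ, rfl⟩ := NCSaito.exists_mem_tail_of_le_order (r := 2)
    (show ((2 : ℕ) : ℕ∞) + 1 ≤ _ by norm_num; exact hord)
  obtain ⟨N, hN⟩ := NCSaito.exists_tail_le_jac φ hfin
  refine ⟨⟨NCSaito.exists_isWeightedHomogeneous hφ hN, ?_⟩, ?_⟩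
  · rintro ⟨r, -, h⟩
    obtain ⟨ξ, hd, -, hξ, -⟩ := NCSaito.exists_isDer_of_isWeightedHomogeneous h
    exact NCSaito.isQuasiHomogeneous_of_isDer hd hξ
  · intro r s _ _ hr hs
    obtain ⟨ξ, hξ, hξX, hξφ, hξc⟩ := NCSaito.exists_isDer_of_isWeightedHomogeneous hr
    obtain ⟨η, hη, hηX, hηφ, hηc⟩ := NCSaito.exists_isDer_of_isWeightedHomogeneous hs
    refine NCSaito.exists_perm_of_prod_eq (k := k) ?_
    rw [← hξc, ← hηc]
    exact NCSaito.charpoly_linPart_eq hφ hN hξ hη hξX hηX hξφ hηφ
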